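/- Let $1/2<H<1$ and $\gamma\in(0,2H)$. On some probability space let $B^H=\{B^H_t,\,t\ge 0\}$ be a fractional Brownian motion with Hurst parameter $H$, that is, a centered Gaussian process with covariance $\frac12\left(t^{2H}+s^{2H}-|t-s|^{2H}\right)$, and let $Z=\{Z_t,\,t>0\}$ be a centered Gaussian process, independent of $B^H$, with covariance $\mathbb{E}(Z_tZ_s)=(t+s)^{-\gamma}$. Let $G=\{G_t,\,t\ge 0\}$ be a (measurable, for instance almost surely continuous) centered Gaussian process on a probability space, with covariance function $$\mathbb{E}(G_tG_s)=\mathbb{E}\left[\left(\int_0^t Z_{t-r}\,dB^H_r\right)\left(\int_0^s Z_{s-r}\,dB^H_r\right)\right],\qquad s,t\ge 0,$$ where $\int_0^t Z_{t-r}\,dB^H_r$ is the limit in $L^2$ of the sums $\sum_{i<n} Z_{t-r_i}\left(B^H_{r_{i+1}}-B^H_{r_i}\right)$ over partitions $0=r_0<r_1<\dots<r_n=t$ as the mesh tends to $0$. Then almost all paths of $G$ belong to the Besov--Orlicz space $\mathcal{B}^{H-\gamma/2}_{\Phi_2,\infty}(0,1)$. Here, for $I=(0,1)$, $I(h)=\{s\in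 I: s+h\in I\}$, $\Phi_2(x)=e^{x^2}-1$ and $\|g\|_{L^{\Phi_2}(S)}=\sup_{p\ge 1}p^{-1/2}\|g\|_{L^p(S)}$, the space $\mathcal{B}^{\alpha}_{\Phi_2,\infty}(0,1)$, for $\alpha\in(0,1)$, consists of the measurable functions $f$ on $I$ (up to almost everywhere equality) such that $$\|f\|_{L^{\Phi_2}(I)}<\infty\qquad\text{and}\qquad \sup_{0<t\le 1}t^{-\alpha}\sup_{|h|\le t}\|f(\cdot+h)-f(\cdot)\|_{L^{\Phi_2}(I(h))}<\infty .$$ -/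

import Mathlib

open MeasureTheory ProbabilityTheory
open scoped ENNReal

noncomputable section

/-- The exponential Orlicz norm `sup_{p ≥ 1} p^{-1/β} ‖f‖_{L^p(S)}`, associated with the Young
function `x ↦ exp (x^β) - 1`. -/
def expOrliczNorm (β : ℝ) (S : Set ℝ) (f : ℝ → ℝ) : ℝ≥0∞ :=
  ⨆ (p : ℝ) (_ : 1 ≤ p),
    ENNReal.ofReal (p ^ (-(1 / β))) * eLpNorm f (ENNReal.ofReal p) (volume.restrict S)

/-- `I(h) = {s ∈ I : s + h ∈ I}` for the interval `I = (0,1)`. -/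
def shiftDomain (h : ℝ) : Set ℝ :=
  {s | s ∈ Set.Ioo (0 : ℝ) 1 ∧ s + h ∈ Set.Ioo (0 : ℝ) 1}

/-- The modulus of smoothness `sup_{|h| ≤ t} ‖f(· + h) - f‖` in the exponential Orlicz norm
over `I(h)`. -/
def orliczModulus (β : ℝ) (f : ℝ → ℝ) (t : ℝ) : ℝ≥0∞ :=
  ⨆ (h : ℝ) (_ : |h| ≤ t), expOrliczNorm β (shiftDomain h) (fun s => f (s + h) - f s)

/-- The Besov-Orlicz seminorm `sup_{0 < t ≤ 1} t^{-α} ω(f, t)`. -/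
def besovOrliczSeminorm (α β : ℝ) (f : ℝ → ℝ) : ℝ≥0∞ :=
  ⨆ (t : ℝ) (_ : 0 < t ∧ t ≤ 1), ENNReal.ofReal (t ^ (-α)) * orliczModulus β f t

/-- Membership of (the restriction to `(0,1)` of) `f` in the Besov-Orlicz space
`B^α_{Φ_β,∞}(0,1)`, with `Φ_β(x) = exp (x^β) - 1`: the function is measurable up to a null set,
and both its exponential Orlicz norm and its Besov-Orlicz seminorm are finite. -/
def MemBesovOrlicz (α β : ℝ) (f : ℝ → ℝ) : Prop :=
  AEStronglyMeasurable f (volume.restrict (Set.Ioo (0 : ℝ) 1)) ∧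
    expOrliczNorm β (Set.Ioo (0 : ℝ) 1) f < ∞ ∧ besovOrliczSeminorm α β f < ∞

/-- `(X_t)_{t ∈ T}` is a centered Gaussian process with covariance function `C` on `T`.
Values of `X` and `C` at times outside `T` play no role. -/
structure IsCenteredGaussianOn {Ω : Type*} [MeasurableSpace Ω] (T : Set ℝ) (C : ℝ → ℝ → ℝ)
    (X : ℝ → Ω → ℝ) (P : Measure Ω) : Prop where
  gaussian : IsGaussianProcess (fun t : T => X t) P
  centered : ∀ t ∈ T, ∫ ω, X t ω ∂P = 0
  covariance : ∀ t ∈ T, ∀ s ∈ T, ∫ ω, X t ω * X s ω ∂P = C t s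

/-- `(B_t)_{t ≥ 0}` is a fractional Brownian motion with Hurst parameter `H`. -/
def IsFractionalBrownianMotion {Ω : Type*} [MeasurableSpace Ω] (H : ℝ)
    (B : ℝ → Ω → ℝ) (P : Measure Ω) : Prop :=
  IsCenteredGaussianOn (Set.Ici 0)
    (fun t s => (t ^ (2 * H) + s ^ (2 * H) - |t - s| ^ (2 * H)) / 2) B P

/-- The left-point Riemann sum `∑_{i<n} Z_{t - r_i} (B_{r_{i+1}} - B_{r_i})`. -/
def convolutionSum {Ω : Type*} (Z B : ℝ → Ω → ℝ) (t : ℝ) (n : ℕ) (r : ℕ → ℝ) (ω : Ω) : ℝ :=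
  ∑ i ∈ Finset.range n, Z (t - r i) ω * (B (r (i + 1)) ω - B (r i) ω)

/-- `J` is the stochastic integral `∫_0^t Z_{t-r} dB_r`: the limit in `L²(P)` of the left-point
Riemann sums over the partitions `0 = r_0 < r_1 < ⋯ < r_n = t`, as the mesh tends to zero.
Only values of `Z` at positive times enter. -/
def IsConvolutionIntegral {Ω : Type*} [MeasurableSpace Ω] (P : Measure Ω)
    (Z B : ℝ → Ω → ℝ) (t : ℝ) (J : Ω → ℝ) : Prop :=
  MemLp J 2 P ∧
    ∀ ε : ℝ, 0 < ε → ∃ δ : ℝ, 0 < δ ∧ ∀ (n : ℕ) (r : ℕ → ℝ), r 0 = 0 → r n = t →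
      (∀ i < n, r i < r (i + 1) ∧ r (i + 1) - r i < δ) →
        eLpNorm (fun ω => convolutionSum Z B t n r ω - J ω) 2 P ≤ ENNReal.ofReal ε

end

open Filter Topology

/-! The covariance of `G` is `H(2H-1) ∬ (t-r+s-r')^(-γ) |r-r'|^(2H-2) dr dr'` over `(0,t) × (0,s)`.
Independence factors the expectation of a product of Riemann sums, and for `H > 1/2` the increments
of `B` have covariance density `H(2H-1) |r-r'|^(2H-2)` (`integral_convolutionIntegral_mul`).

Since `u^(-γ) = Γ(γ)⁻¹ ∫ x^(γ-1) e^(-xu) dx`, the kernel is a mixture of products of a function of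
`r` and a function of `r'`. A second difference of the covariance is then a mixture of products of
first differences, each bounded by `1` and of `L¹` norm at most `2 min(h, 1/x)`. The Riesz potential
estimate bounds the second difference by a multiple of `∫ x^(γ-1) min(h, 1/x)^(2H) dx`, of order
`h^(2H-γ)` (`incrEnergy_le`). Averaging over one time variable first removes the singularity and
gives the smaller order `h^(2-γ)` (`lintegral_incrEnergy_le`). The gain is `h^(2-2H)`: distant
increments are weakly correlated in the mean.

On the Gaussian side let `α = H - γ/2`, let `h = 2^(-n-1)`, and let `X_n(s)` be the increment of `G`
over `[s, s+h]` divided by a multiple of `h^α` that makes its variance at most `1/8`. The variables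
`F_n = ∫ exp(X_n(s)²) ds` have bounded means, and a decorrelation inequality
(`HasGaussianMGF.lintegral_exp_sq_add_sq_le`) bounds their variances by a multiple of `∬ |E X_n(s)
X_n(t)| ds dt`, which is summable in `n`. Hence `sup_n F_n` is almost surely finite, and so the
Orlicz norms of the dyadic increments are almost surely `O(h^α)`. Binary expansion of the step
passes from dyadic to arbitrary increments (`memBesovOrlicz_of_dyadic`). -/

/-! ### Exponential Orlicz norms and shift domains. -/

/-- From `y ≤ e^y` at `y = f²/p` one gets `|f|^p ≤ p^(p/2) e^(f²)`. The `p`-th root produces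
`p^(1/2)`, which the weight cancels, and `1 ≤ M` makes `M^(1/p) ≤ M` uniformly in `p`. -/
theorem expOrliczNorm_two_le_of_lintegral_exp_sq {S : Set ℝ} {f : ℝ → ℝ} {M : ℝ≥0∞} (hM : 1 ≤ M)
    (h : ∫⁻ s in S, ENNReal.ofReal (Real.exp (f s ^ 2)) ≤ M) : expOrliczNorm 2 S f ≤ M := by
  refine iSup₂_le fun p hp => ?_
  have hp0 : 0 < p := by linarith
  have hpt : ∀ s, ‖f s‖ₑ ^ p ≤
      ENNReal.ofReal (p ^ (p / 2)) * ENNReal.ofReal (Real.exp (f s ^ 2)) := by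
    intro s
    rw [← ofReal_norm, ENNReal.ofReal_rpow_of_nonneg (norm_nonneg _) hp0.le,
      ← ENNReal.ofReal_mul (by positivity)]
    apply ENNReal.ofReal_le_ofReal
    have h1 : ‖f s‖ ^ p = p ^ (p / 2) * (f s ^ 2 / p) ^ (p / 2) := by
      rw [← Real.mul_rpow hp0.le (by positivity), mul_div_cancel₀ _ hp0.ne', ← sq_abs,
        ← Real.rpow_natCast, ← Real.rpow_mul (abs_nonneg _), Real.norm_eq_abs]
      congr 1
      push_cast
      ring
    rw [h1]
    gcongr
    calc (f s ^ 2 / p) ^ (p / 2) ≤ (Real.exp (f s ^ 2 / p)) ^ (p / 2) := by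
          gcongr
          linarith [Real.add_one_le_exp (f s ^ 2 / p)]
      _ = Real.exp (f s ^ 2 / 2) := by
          rw [← Real.exp_mul]
          congr 1
          field_simp
      _ ≤ _ := Real.exp_le_exp.2 (by nlinarith [sq_nonneg (f s)])
  have hN : eLpNorm f (ENNReal.ofReal p) (volume.restrict S) ≤ ENNReal.ofReal (p ^ (1 / 2 : ℝ)) * M := by
    rw [eLpNorm_eq_lintegral_rpow_enorm_toReal (by simpa using hp0) ENNReal.ofReal_ne_top,
      ENNReal.toReal_ofReal hp0.le]
    calc (∫⁻ s in S, ‖f s‖ₑ ^ p) ^ (1 / p) ≤ (ENNReal.ofReal (p ^ (p / 2)) * M) ^ (1 / p) := by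
          gcongr
          refine (lintegral_mono hpt).trans ?_
          rw [lintegral_const_mul' _ _ ENNReal.ofReal_ne_top]
          gcongr
      _ = ENNReal.ofReal (p ^ (1 / 2 : ℝ)) * M ^ (1 / p) := by
          rw [ENNReal.mul_rpow_of_nonneg _ _ (by positivity),
            ENNReal.ofReal_rpow_of_nonneg (by positivity) (by positivity), ← Real.rpow_mul hp0.le]
          congr 3
          field_simp
      _ ≤ _ := by
          gcongr
          conv_rhs => rw [← ENNReal.rpow_one M]
          exact ENNReal.rpow_le_rpow_of_exponent_le hM (by rw [div_le_one hp0]; exact hp)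
  calc ENNReal.ofReal (p ^ (-(1 / 2) : ℝ)) * eLpNorm f (ENNReal.ofReal p) (volume.restrict S)
      ≤ ENNReal.ofReal (p ^ (-(1 / 2) : ℝ)) * (ENNReal.ofReal (p ^ (1 / 2 : ℝ)) * M) := by gcongr
    _ = M := by
        rw [← mul_assoc, ← ENNReal.ofReal_mul (by positivity), ← Real.rpow_add hp0]
        simp

theorem expOrliczNorm_const_mul (β : ℝ) (S : Set ℝ) (c : ℝ) (f : ℝ → ℝ) :
    expOrliczNorm β S (fun s => c * f s) = ENNReal.ofReal |c| * expOrliczNorm β S f := by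
  unfold expOrliczNorm
  simp_rw [ENNReal.mul_iSup]
  refine iSup_congr fun p => iSup_congr fun _ => ?_
  have : (fun s => c * f s) = c • f := rfl
  rw [this, eLpNorm_const_smul, ← ofReal_norm, Real.norm_eq_abs]
  ring

theorem expOrliczNorm_congr_ae {β : ℝ} {S : Set ℝ} {f g : ℝ → ℝ} (h : f =ᵐ[volume.restrict S] g) :
    expOrliczNorm β S f = expOrliczNorm β S g := by
  unfold expOrliczNorm
  simp_rw [eLpNorm_congr_ae h]

theorem measurableSet_shiftDomain (h : ℝ) : MeasurableSet (shiftDomain h) :=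
  measurableSet_Ioo.inter (measurableSet_Ioo.preimage (measurable_id.add_const h))

theorem measurePreserving_add_restrict_shiftDomain (h : ℝ) :
    MeasurePreserving (· + h) (volume.restrict (shiftDomain h))
      (volume.restrict (shiftDomain (-h))) := by
  have := (measurePreserving_add_right (volume : Measure ℝ) h).restrict_preimage
    (measurableSet_shiftDomain (-h))
  convert this using 2
  ext s
  simp [shiftDomain, and_comm]

/-- Makes null-set modifications harmless for increments; used both for paths and for the
time-indexed family of random variables. -/
theorem ae_restrict_shiftDomain {p : ℝ → Prop} (h : ∀ᵐ s ∂volume.restrict (Set.Ioo (0 : ℝ) 1), p s)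
    (u : ℝ) : ∀ᵐ s ∂volume.restrict (shiftDomain u), p s ∧ p (s + u) := by
  have hsub : ∀ v, shiftDomain v ⊆ Set.Ioo (0 : ℝ) 1 := fun v s hs => hs.1
  exact (ae_restrict_of_ae_restrict_of_subset (hsub u) h).and
    ((measurePreserving_add_restrict_shiftDomain u).quasiMeasurePreserving.ae
      (ae_restrict_of_ae_restrict_of_subset (hsub (-u)) h))

theorem MemBesovOrlicz.congr_ae {α β : ℝ} {f g : ℝ → ℝ} (hf : MemBesovOrlicz α β f)
    (h : f =ᵐ[volume.restrict (Set.Ioo (0 : ℝ) 1)] g) : MemBesovOrlicz α β g := by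
  refine ⟨hf.1.congr h, expOrliczNorm_congr_ae h ▸ hf.2.1, ?_⟩
  convert hf.2.2 using 1
  refine iSup_congr fun t => iSup_congr fun _ => congrArg _ (iSup_congr fun u => iSup_congr fun _ =>
    expOrliczNorm_congr_ae ?_)
  filter_upwards [ae_restrict_shiftDomain h u] with s hs
  rw [hs.1, hs.2]

/-! ### From dyadic increments to all increments. -/

theorem tendsto_eLpNorm_translate_sub {f : ℝ → ℝ} {p : ℝ≥0∞} (hp1 : 1 ≤ p) (hp : p ≠ ∞)
    (hf : MemLp f p volume) (h : ℝ) :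
    Tendsto (fun d => eLpNorm (fun s => f (s + d) - f (s + h)) p volume) (𝓝 h) (𝓝 0) := by
  have : Fact (1 ≤ p) := ⟨hp1⟩
  let g : C(ℝ, C(ℝ, ℝ)) := (ContinuousMap.mk (fun a : ℝ × ℝ => a.2 + a.1) (by fun_prop)).curry
  have hm : ∀ d : ℝ, MeasurePreserving (g d) (volume : Measure ℝ) volume :=
    fun d => measurePreserving_add_right volume d
  have hc : Tendsto (fun d => Lp.compMeasurePreserving (g d) (hm d) (hf.toLp f)) (𝓝 h)
      (𝓝 (Lp.compMeasurePreserving (g h) (hm h) (hf.toLp f))) :=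
    Filter.Tendsto.compMeasurePreservingLp tendsto_const_nhds (g.continuous.tendsto h) hm (hm h) hp
  rw [tendsto_iff_edist_tendsto_0] at hc
  refine hc.congr fun d => ?_
  rw [Lp.toLp_compMeasurePreserving hf (hm d), Lp.toLp_compMeasurePreserving hf (hm h),
    Lp.edist_toLp_toLp]
  rfl

/-- If `s` and `s + h` lie in `(0,1)`, so do `s + d` and `s + d + δ`; translation by `d` therefore
maps `I(h)` into `I(δ)`. -/
theorem eLpNorm_increment_translate_le {f : ℝ → ℝ} (hf : Measurable f) (p : ℝ≥0∞) {h d δ : ℝ}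
    (hd : 0 ≤ d) (hδ : 0 ≤ δ) (hh : d + δ ≤ h) :
    eLpNorm (fun s => f (s + (d + δ)) - f (s + d)) p (volume.restrict (shiftDomain h)) ≤
      eLpNorm (fun s => f (s + δ) - f s) p (volume.restrict (shiftDomain δ)) := by
  have hmp := (measurePreserving_add_right (volume : Measure ℝ) d).restrict_preimage
    (measurableSet_shiftDomain δ)
  rw [← eLpNorm_comp_measurePreserving (by fun_prop) hmp]
  have hcomp : (fun s => f (s + (d + δ)) - f (s + d)) = (fun s => f (s + δ) - f s) ∘ (· + d) := by
    ext s
    simp only [Function.comp]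
    ring_nf
  rw [hcomp]
  refine eLpNorm_mono_measure _ (Measure.restrict_mono ?_ le_rfl)
  · rintro s ⟨⟨h1, h2⟩, h3, h4⟩
    refine ⟨⟨?_, ?_⟩, ?_, ?_⟩ <;> simp only <;> linarith

/-- `⌊2^m h⌋ / 2^m` keeps the first `m` binary digits of `h`. Each new nonzero digit costs one
dyadic increment, and only scales not exceeding `h` can occur. -/
theorem eLpNorm_increment_floor_le {f : ℝ → ℝ} (hf : Measurable f) {p : ℝ≥0∞} (hp1 : 1 ≤ p)
    {h : ℝ} (h0 : 0 < h) (h1 : h < 1) (m : ℕ) :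
    eLpNorm (fun s => f (s + ⌊2 ^ m * h⌋₊ / 2 ^ m) - f s) p (volume.restrict (shiftDomain h)) ≤
      ∑ n ∈ Finset.range m, if (1 / 2 : ℝ) ^ (n + 1) ≤ h then
        eLpNorm (fun s => f (s + (1 / 2) ^ (n + 1)) - f s) p
          (volume.restrict (shiftDomain ((1 / 2) ^ (n + 1)))) else 0 := by
  induction m with
  | zero =>
    have : ⌊h⌋₊ = 0 := Nat.floor_eq_zero.2 h1
    simp [this]
  | succ m ih =>
    rw [Finset.sum_range_succ]
    set k := ⌊2 ^ m * h⌋₊ with hk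
    have hk1 : (k : ℝ) ≤ 2 ^ m * h := Nat.floor_le (by positivity)
    have hk2 : 2 ^ m * h < k + 1 := Nat.lt_floor_add_one _
    have hpow : (0 : ℝ) < 2 ^ m := by positivity
    have hcase : ⌊2 ^ (m + 1) * h⌋₊ = 2 * k ∨ ⌊2 ^ (m + 1) * h⌋₊ = 2 * k + 1 := by
      have e : (2 : ℝ) ^ (m + 1) * h = 2 * (2 ^ m * h) := by ring
      have l1 : 2 * k ≤ ⌊2 ^ (m + 1) * h⌋₊ := Nat.le_floor (by rw [e]; push_cast; linarith)
      have l2 : ⌊2 ^ (m + 1) * h⌋₊ < 2 * k + 2 :=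
        (Nat.floor_lt (by positivity)).2 (by rw [e]; push_cast; linarith)
      omega
    rcases hcase with hc | hc
    · have : ((⌊2 ^ (m + 1) * h⌋₊ : ℕ) : ℝ) / 2 ^ (m + 1) = k / 2 ^ m := by
        rw [hc]; push_cast; field_simp; ring
      rw [this]
      exact ih.trans le_self_add
    · have e : ((⌊2 ^ (m + 1) * h⌋₊ : ℕ) : ℝ) / 2 ^ (m + 1) = k / 2 ^ m + (1 / 2) ^ (m + 1) := by
        rw [hc, one_div, inv_pow]; push_cast; field_simp; ring
      have hle : (k : ℝ) / 2 ^ m + (1 / 2) ^ (m + 1) ≤ h := by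
        rw [← e, div_le_iff₀ (by positivity), mul_comm h]
        exact Nat.floor_le (by positivity)
      have hk0 : (0 : ℝ) ≤ k / 2 ^ m := by positivity
      rw [e, if_pos (by linarith)]
      have hsplit : (fun s => f (s + (k / 2 ^ m + (1 / 2) ^ (m + 1))) - f s) =
          (fun s => f (s + k / 2 ^ m) - f s) +
          fun s => f (s + (k / 2 ^ m + (1 / 2) ^ (m + 1))) - f (s + k / 2 ^ m) := by
        ext s; simp
      rw [hsplit]
      refine (eLpNorm_add_le (by fun_prop) (by fun_prop) hp1).trans (add_le_add ih ?_)
      exact eLpNorm_increment_translate_le hf p hk0 (by positivity) hle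

/-- The binary truncations converge to `h`, and continuity of translations in `L^p`, applied to the
extension of `f` by zero, replaces continuity of `f`. -/
theorem eLpNorm_increment_le_tsum_dyadic {f : ℝ → ℝ} (hf : Measurable f) {p : ℝ≥0∞} (hp1 : 1 ≤ p)
    (hp : p ≠ ∞) (hfp : MemLp f p (volume.restrict (Set.Ioo (0 : ℝ) 1)))
    {h : ℝ} (h0 : 0 < h) (h1 : h < 1) :
    eLpNorm (fun s => f (s + h) - f s) p (volume.restrict (shiftDomain h)) ≤
      ∑' n : ℕ, if (1 / 2 : ℝ) ^ (n + 1) ≤ h then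
        eLpNorm (fun s => f (s + (1 / 2) ^ (n + 1)) - f s) p
          (volume.restrict (shiftDomain ((1 / 2) ^ (n + 1)))) else 0 := by
  set T := ∑' n : ℕ, if (1 / 2 : ℝ) ^ (n + 1) ≤ h then
        eLpNorm (fun s => f (s + (1 / 2) ^ (n + 1)) - f s) p
          (volume.restrict (shiftDomain ((1 / 2) ^ (n + 1)))) else 0
  set F := (Set.Ioo (0 : ℝ) 1).indicator f
  have hF : MemLp F p volume := (memLp_indicator_iff_restrict measurableSet_Ioo).2 hfp
  have hd : Tendsto (fun m : ℕ => (⌊2 ^ m * h⌋₊ : ℝ) / 2 ^ m) atTop (𝓝 h) := by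
    have := (tendsto_nat_floor_mul_div_atTop (R := ℝ) h0.le).comp
      (tendsto_pow_atTop_atTop_of_one_lt (one_lt_two : (1 : ℝ) < 2))
    simpa [Function.comp_def, mul_comm] using this
  have hlim := (tendsto_eLpNorm_translate_sub hp1 hp hF h).comp hd
  have hlim' := hlim.add_const T
  rw [zero_add] at hlim'
  refine ge_of_tendsto' hlim' fun m => ?_
  set d : ℝ := (⌊2 ^ m * h⌋₊ : ℝ) / 2 ^ m with hddef
  have hd0 : 0 ≤ d := by positivity
  have hdh : d ≤ h := by
    rw [hddef, div_le_iff₀ (by positivity), mul_comm h]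
    exact Nat.floor_le (by positivity)
  have hsplit : (fun s => f (s + h) - f s) =
      (fun s => f (s + h) - f (s + d)) + fun s => f (s + d) - f s := by
    ext s; simp
  rw [hsplit]
  refine (eLpNorm_add_le (by fun_prop) (by fun_prop) hp1).trans (add_le_add ?_ ?_)
  · rw [← eLpNorm_neg]
    refine (eLpNorm_congr_ae (g := fun s => F (s + d) - F (s + h)) ?_).trans_le
      (eLpNorm_mono_measure _ Measure.restrict_le_self)
    filter_upwards [ae_restrict_mem (measurableSet_shiftDomain h)] with s hs
    obtain ⟨⟨a1, a2⟩, a3, a4⟩ := hs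
    have m1 : s + h ∈ Set.Ioo (0 : ℝ) 1 := ⟨a3, a4⟩
    have m2 : s + d ∈ Set.Ioo (0 : ℝ) 1 := ⟨by linarith, by linarith⟩
    simp only [F, Set.indicator_of_mem m1, Set.indicator_of_mem m2, Pi.neg_apply]
    ring
  · exact (eLpNorm_increment_floor_le hf hp1 h0 h1 m).trans (ENNReal.sum_le_tsum _)

/-- The sum starts at the first dyadic scale below `h` and is geometric with ratio `2^(-α)` from
there. -/
theorem tsum_dyadic_rpow_le {α h : ℝ} (hα : 0 < α) (h0 : 0 < h) :
    ∑' n : ℕ, (if (1 / 2 : ℝ) ^ (n + 1) ≤ h then ENNReal.ofReal (((1 / 2 : ℝ) ^ (n + 1)) ^ α) else 0) ≤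
      ENNReal.ofReal (h ^ α * (1 - (1 / 2) ^ α)⁻¹) := by
  have hex : ∃ n : ℕ, (1 / 2 : ℝ) ^ (n + 1) ≤ h := by
    obtain ⟨n, hn⟩ := exists_pow_lt_of_lt_one h0 (by norm_num : (1 / 2 : ℝ) < 1)
    exact ⟨n, (pow_le_pow_of_le_one (by norm_num) (by norm_num) (Nat.le_succ n)).trans hn.le⟩
  obtain ⟨N, hN, hmin⟩ : ∃ N : ℕ, (1 / 2 : ℝ) ^ (N + 1) ≤ h ∧
      ∀ m < N, ¬(1 / 2 : ℝ) ^ (m + 1) ≤ h := by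
    classical
    exact ⟨Nat.find hex, Nat.find_spec hex, fun m => Nat.find_min hex⟩
  have hρ0 : 0 < (1 / 2 : ℝ) ^ α := by positivity
  have hρ1 : (1 / 2 : ℝ) ^ α < 1 := Real.rpow_lt_one (by norm_num) (by norm_num) hα
  have hpow : ∀ n : ℕ, ((1 / 2 : ℝ) ^ n) ^ α = ((1 / 2 : ℝ) ^ α) ^ n := fun n => by
    rw [← Real.rpow_natCast, ← Real.rpow_mul (by norm_num), mul_comm, Real.rpow_mul (by norm_num),
      Real.rpow_natCast]
  generalize (1 / 2 : ℝ) ^ α = ρ at *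
  obtain ⟨a, ha⟩ : ∃ a : ℕ → ℝ≥0∞, ∀ n, a n =
    if (1 / 2 : ℝ) ^ (n + 1) ≤ h then ENNReal.ofReal (((1 / 2 : ℝ) ^ (n + 1)) ^ α) else 0 :=
    ⟨_, fun _ => rfl⟩
  simp_rw [← ha]
  have hz : ∑ n ∈ Finset.range N, a n = 0 :=
    Finset.sum_eq_zero fun n hn => by rw [ha, if_neg (hmin n (Finset.mem_range.1 hn))]
  rw [← Summable.sum_add_tsum_nat_add' (f := a) (k := N) ENNReal.summable, hz, zero_add]
  calc ∑' i, a (i + N) ≤ ∑' i : ℕ, ENNReal.ofReal (h ^ α * ρ ^ i) := by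
        refine ENNReal.tsum_le_tsum fun i => ?_
        rw [ha]
        split_ifs
        · refine ENNReal.ofReal_le_ofReal ?_
          have : (1 / 2 : ℝ) ^ (i + N + 1) = (1 / 2) ^ (N + 1) * (1 / 2) ^ i := by ring
          rw [this, Real.mul_rpow (by positivity) (by positivity), hpow i]
          gcongr
        · simp
    _ = _ := by
        rw [← ENNReal.ofReal_tsum_of_nonneg (fun i => by positivity)
          ((summable_geometric_of_lt_one hρ0.le hρ1).mul_left _), tsum_mul_left,
          tsum_geometric_of_lt_one hρ0.le hρ1]

theorem expOrliczNorm_increment_le_of_dyadic {α β : ℝ} (hα : 0 < α) {f : ℝ → ℝ} (hf : Measurable f)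
    (hfI : expOrliczNorm β (Set.Ioo (0 : ℝ) 1) f < ∞) {M : ℝ≥0∞}
    (hM : ∀ n : ℕ, expOrliczNorm β (shiftDomain ((1 / 2) ^ (n + 1)))
      (fun s => f (s + (1 / 2) ^ (n + 1)) - f s) ≤ M * ENNReal.ofReal (((1 / 2 : ℝ) ^ (n + 1)) ^ α))
    {h : ℝ} (h0 : 0 < h) (h1 : h < 1) :
    expOrliczNorm β (shiftDomain h) (fun s => f (s + h) - f s) ≤
      M * ENNReal.ofReal (h ^ α * (1 - (1 / 2) ^ α)⁻¹) := by
  refine iSup₂_le fun p hp => ?_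
  have hp0 : 0 < p := by linarith
  have hle : ∀ (S : Set ℝ) (g : ℝ → ℝ),
      ENNReal.ofReal (p ^ (-(1 / β))) * eLpNorm g (ENNReal.ofReal p) (volume.restrict S) ≤
        expOrliczNorm β S g := fun S g =>
    le_iSup₂ (f := fun (p : ℝ) (_ : 1 ≤ p) =>
      ENNReal.ofReal (p ^ (-(1 / β))) * eLpNorm g (ENNReal.ofReal p) (volume.restrict S)) p hp
  have hpp : 0 < p ^ (-(1 / β)) := by positivity
  have hmem : MemLp f (ENNReal.ofReal p) (volume.restrict (Set.Ioo (0 : ℝ) 1)) := by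
    refine ⟨hf.aestronglyMeasurable, lt_top_iff_ne_top.2 fun htop => ?_⟩
    have := (hle (Set.Ioo 0 1) f).trans_lt hfI
    rw [htop, ENNReal.mul_top (by simpa using hpp)] at this
    exact lt_irrefl _ this
  have hp1 : 1 ≤ ENNReal.ofReal p := by simpa using hp
  calc _ ≤ ENNReal.ofReal (p ^ (-(1 / β))) * _ :=
        mul_le_mul_right (eLpNorm_increment_le_tsum_dyadic hf hp1 ENNReal.ofReal_ne_top hmem h0 h1) _
    _ ≤ M * ∑' n : ℕ, (if (1 / 2 : ℝ) ^ (n + 1) ≤ h then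
          ENNReal.ofReal (((1 / 2 : ℝ) ^ (n + 1)) ^ α) else 0) := by
        rw [← ENNReal.tsum_mul_left, ← ENNReal.tsum_mul_left]
        refine ENNReal.tsum_le_tsum fun n => ?_
        split_ifs
        · exact (hle _ _).trans (hM n)
        · simp
    _ ≤ _ := mul_le_mul_right (tsum_dyadic_rpow_le hα h0) _

theorem expOrliczNorm_increment_neg (β : ℝ) {f : ℝ → ℝ} (hf : Measurable f) (h : ℝ) :
    expOrliczNorm β (shiftDomain (-h)) (fun s => f (s + -h) - f s) =
      expOrliczNorm β (shiftDomain h) (fun s => f (s + h) - f s) := by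
  refine iSup_congr fun p => iSup_congr fun _ => congrArg _ ?_
  rw [← eLpNorm_comp_measurePreserving (by fun_prop) (measurePreserving_add_restrict_shiftDomain h),
    ← eLpNorm_neg]
  congr 1
  ext s
  simp

theorem memBesovOrlicz_of_dyadic {α β : ℝ} (hα : 0 < α) {f : ℝ → ℝ} (hf : Measurable f)
    (hfI : expOrliczNorm β (Set.Ioo (0 : ℝ) 1) f < ∞) {M : ℝ≥0∞} (hMtop : M < ∞)
    (hM : ∀ n : ℕ, expOrliczNorm β (shiftDomain ((1 / 2) ^ (n + 1)))
      (fun s => f (s + (1 / 2) ^ (n + 1)) - f s) ≤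
        M * ENNReal.ofReal (((1 / 2 : ℝ) ^ (n + 1)) ^ α)) :
    MemBesovOrlicz α β f := by
  refine ⟨hf.aestronglyMeasurable, hfI, ?_⟩
  set C : ℝ := (1 - (1 / 2) ^ α)⁻¹
  have hC : 0 < C :=
    inv_pos.2 (sub_pos.2 (Real.rpow_lt_one (by norm_num) (by norm_num) hα))
  refine lt_of_le_of_lt (b := M * ENNReal.ofReal C) ?_ (ENNReal.mul_lt_top hMtop ENNReal.ofReal_lt_top)
  refine iSup₂_le fun t ht => ?_
  rw [orliczModulus]
  simp_rw [ENNReal.mul_iSup]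
  refine iSup₂_le fun h hh => ?_
  have hpos : ∀ u : ℝ, 0 < u → u ≤ t →
      ENNReal.ofReal (t ^ (-α)) * expOrliczNorm β (shiftDomain u) (fun s => f (s + u) - f s) ≤
        M * ENNReal.ofReal C := by
    intro u hu hut
    rcases lt_or_ge u 1 with hu1 | hu1
    · calc _ ≤ ENNReal.ofReal (t ^ (-α)) * (M * ENNReal.ofReal (u ^ α * C)) :=
            mul_le_mul_right (expOrliczNorm_increment_le_of_dyadic hα hf hfI hM hu hu1) _
        _ = M * ENNReal.ofReal (t ^ (-α) * (u ^ α * C)) := by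
            rw [ENNReal.ofReal_mul (p := t ^ (-α)) (by have := ht.1; positivity)]; ring
        _ ≤ _ := by
            gcongr
            rw [← mul_assoc]
            refine mul_le_of_le_one_left hC.le ?_
            rw [Real.rpow_neg ht.1.le, inv_mul_le_iff₀ (Real.rpow_pos_of_pos ht.1 _), mul_one]
            gcongr
    · have : shiftDomain u = ∅ := by
        ext s
        simp only [shiftDomain, Set.mem_ofPred_eq, Set.mem_Ioo, Set.mem_empty_iff_false, iff_false]
        intro hs
        linarith [hs.1.1, hs.2.2]
      simp [this, expOrliczNorm]
  rcases lt_trichotomy h 0 with hn | rfl | hp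
  · have := hpos (-h) (by linarith) (by rwa [abs_of_neg hn] at hh)
    rwa [expOrliczNorm_increment_neg β hf h] at this
  · simp [expOrliczNorm]
  · exact hpos h hp (by rwa [abs_of_pos hp] at hh)

/-! ### Squared exponentials of Gaussian variables and their decorrelation. -/

theorem lintegral_exp_mul_gaussianReal (v : NNReal) (t : ℝ) :
    ∫⁻ x, ENNReal.ofReal (Real.exp (t * x)) ∂gaussianReal 0 v =
      ENNReal.ofReal (Real.exp (v * t ^ 2 / 2)) := by
  rw [← ofReal_integral_eq_lintegral_ofReal (integrable_exp_mul_gaussianReal t)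
    (ae_of_all _ fun _ => (Real.exp_pos _).le)]
  have := congrFun (mgf_id_gaussianReal (μ := 0) (v := v)) t
  simp only [mgf, id, zero_mul, zero_add] at this
  rw [this]

theorem lintegral_exp_sq_gaussianReal_lt_top {a : ℝ} (ha : a < 1 / 2) :
    ∫⁻ x, ENNReal.ofReal (Real.exp (a * x ^ 2)) ∂gaussianReal 0 1 < ∞ := by
  rw [gaussianReal_of_var_ne_zero 0 one_ne_zero,
    lintegral_withDensity_eq_lintegral_mul _ (measurable_gaussianPDF 0 1) (by fun_prop)]
  have hint : Integrable (fun x : ℝ => (√(2 * Real.pi))⁻¹ * Real.exp (-(1 / 2 - a) * x ^ 2)) :=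
    (integrable_exp_neg_mul_sq (by linarith)).const_mul _
  refine lt_of_eq_of_lt (lintegral_congr fun x => ?_) hint.lintegral_lt_top
  simp only [Pi.mul_apply, gaussianPDF, gaussianPDFReal]
  rw [← ENNReal.ofReal_mul (by positivity), mul_assoc, ← Real.exp_add]
  congr 3
  · simp
  · simp
    ring

/-- The joint moment generating function of `(X, Y)` is that of the centered Gaussian vector with
variances `a`, `b` and covariance `c`. -/
def HasGaussianMGF {Ω : Type*} [MeasurableSpace Ω] (P : Measure Ω) (X Y : Ω → ℝ) (a b c : ℝ) :
    Prop :=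
  ∀ x y : ℝ, ∫⁻ ω, ENNReal.ofReal (Real.exp (x * X ω + y * Y ω)) ∂P =
    ENNReal.ofReal (Real.exp ((a * x ^ 2 + 2 * c * x * y + b * y ^ 2) / 2))

section

variable {Ω : Type*} [MeasurableSpace Ω] {P : Measure Ω} {X Y : Ω → ℝ} {a b c : ℝ}

/-- Linearization of the square by an auxiliary Gaussian `ξ`: after exchanging integrals,
expectations of `exp(X²)` need only the moment generating function of `X`, and degenerate laws
require no separate treatment. -/
theorem ofReal_exp_sq_eq_lintegral (x : ℝ) :
    ENNReal.ofReal (Real.exp (x ^ 2)) =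
      ∫⁻ ξ, ENNReal.ofReal (Real.exp (√2 * x * ξ)) ∂gaussianReal 0 1 := by
  rw [lintegral_exp_mul_gaussianReal, mul_pow, Real.sq_sqrt (by norm_num)]
  congr 2
  simp

theorem HasGaussianMGF.lintegral_exp_sq [SFinite P] (h : HasGaussianMGF P X Y a b c)
    (hX : Measurable X) :
    ∫⁻ ω, ENNReal.ofReal (Real.exp (X ω ^ 2)) ∂P =
      ∫⁻ ξ, ENNReal.ofReal (Real.exp (a * ξ ^ 2)) ∂gaussianReal 0 1 := by
  simp_rw [ofReal_exp_sq_eq_lintegral]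
  rw [lintegral_lintegral_swap (by fun_prop)]
  refine lintegral_congr fun ξ => ?_
  have := h (√2 * ξ) 0
  simp only [zero_mul, add_zero, mul_zero] at this
  convert this using 1
  · exact lintegral_congr fun ω => by ring_nf
  · rw [mul_pow, Real.sq_sqrt (by norm_num)]
    congr 2
    ring

theorem HasGaussianMGF.symm (h : HasGaussianMGF P X Y a b c) : HasGaussianMGF P Y X b a c := by
  intro x y
  rw [← lintegral_congr fun ω => by rw [add_comm], h y x]
  ring_nf

/-- Convexity gives `e^(A+y) - e^A ≤ |y| e^(A+y)` for the cross term `y = 2cξη`. With `w = ξ² + η²`,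
one has `|y| ≤ |c| w`, `A + y ≤ w/4` and `w ≤ 16 e^(w/16)`; the exponent `5/16 = 1/4 + 1/16` stays
below the Gaussian threshold `1/2`. -/
theorem exp_add_le_exp_add_mul {ξ η : ℝ} (ha : a ≤ 1 / 8) (hb : b ≤ 1 / 8) (hc : |c| ≤ 1 / 8) :
    Real.exp (a * ξ ^ 2 + 2 * c * ξ * η + b * η ^ 2) ≤
      Real.exp (a * ξ ^ 2) * Real.exp (b * η ^ 2) +
        |c| * (16 * (Real.exp (5 / 16 * ξ ^ 2) * Real.exp (5 / 16 * η ^ 2))) := by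
  rw [← Real.exp_add, ← Real.exp_add]
  set A := a * ξ ^ 2 + b * η ^ 2
  set w := ξ ^ 2 + η ^ 2
  set y := 2 * c * ξ * η
  have hw : 0 ≤ w := by positivity
  have hA : A ≤ w / 8 := by
    have := mul_le_mul_of_nonneg_right ha (sq_nonneg ξ)
    have := mul_le_mul_of_nonneg_right hb (sq_nonneg η)
    simp only [A, w]
    linarith
  have hy : |y| ≤ |c| * w := by
    have : |y| = |c| * (2 * |ξ| * |η|) := by simp only [y, abs_mul, abs_two]; ring
    rw [this]
    refine mul_le_mul_of_nonneg_left ?_ (abs_nonneg c)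
    simp only [w]
    rw [← sq_abs ξ, ← sq_abs η]
    nlinarith [sq_nonneg (|ξ| - |η|)]
  have hy8 : |y| ≤ w / 8 := hy.trans (by nlinarith)
  have h1 : Real.exp (A + y) - Real.exp A ≤ |y| * Real.exp (A + y) := by
    have e1 : Real.exp A = Real.exp (A + y) * Real.exp (-y) := by rw [← Real.exp_add]; ring_nf
    have e2 := Real.add_one_le_exp (-y)
    have e3 := Real.exp_pos (A + y)
    have e4 := le_abs_self y
    rw [e1]
    nlinarith [mul_le_mul_of_nonneg_left e2 e3.le, mul_le_mul_of_nonneg_left e4 e3.le]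
  have h2 : w ≤ 16 * Real.exp (w / 16) := by linarith [Real.add_one_le_exp (w / 16)]
  have h3 : |y| * Real.exp (A + y) ≤ |c| * (16 * Real.exp (5 / 16 * ξ ^ 2 + 5 / 16 * η ^ 2)) := by
    calc |y| * Real.exp (A + y) ≤ (|c| * w) * Real.exp (w / 4) := by
          refine mul_le_mul hy (Real.exp_le_exp.2 ?_) (Real.exp_pos _).le (by positivity)
          linarith [le_abs_self y]
      _ ≤ (|c| * (16 * Real.exp (w / 16))) * Real.exp (w / 4) := by gcongr
      _ = _ := by
          rw [mul_assoc, mul_assoc, ← Real.exp_add]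
          simp only [w]
          ring_nf
  have e : a * ξ ^ 2 + y + b * η ^ 2 = A + y := by simp only [A]; ring
  rw [e]
  linarith

/-- The constant of `HasGaussianMGF.lintegral_exp_sq_add_sq_le`. -/
noncomputable def gaussianDecorrelationConst : ℝ≥0∞ :=
  16 * (∫⁻ x, ENNReal.ofReal (Real.exp (5 / 16 * x ^ 2)) ∂gaussianReal 0 1) ^ 2

theorem gaussianDecorrelationConst_lt_top : gaussianDecorrelationConst < ∞ :=
  ENNReal.mul_lt_top (by norm_num)
    (ENNReal.pow_lt_top (lintegral_exp_sq_gaussianReal_lt_top (by norm_num)))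

/-- Linearizing both squares with independent `ξ`, `η` turns the left side into the mean of `exp(aξ²
+ 2cξη + bη²)`. The case `c = 0` is the product of the means, and the pointwise bound makes the
error linear in `|c|`. -/
theorem HasGaussianMGF.lintegral_exp_sq_add_sq_le [SFinite P] (h : HasGaussianMGF P X Y a b c)
    (hX : Measurable X) (hY : Measurable Y) (ha : a ≤ 1 / 8) (hb : b ≤ 1 / 8) (hc : |c| ≤ 1 / 8) :
    ∫⁻ ω, ENNReal.ofReal (Real.exp (X ω ^ 2)) * ENNReal.ofReal (Real.exp (Y ω ^ 2)) ∂P ≤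
      (∫⁻ ω, ENNReal.ofReal (Real.exp (X ω ^ 2)) ∂P) *
        (∫⁻ ω, ENNReal.ofReal (Real.exp (Y ω ^ 2)) ∂P) +
      ENNReal.ofReal |c| * gaussianDecorrelationConst := by
  rw [h.lintegral_exp_sq hX, h.symm.lintegral_exp_sq hY]
  set N := gaussianReal 0 1
  have hprod : ∀ p q : ℝ → ℝ, Measurable p → Measurable q →
      ∫⁻ z, ENNReal.ofReal (Real.exp (p z.1)) * ENNReal.ofReal (Real.exp (q z.2)) ∂(N.prod N) =
        (∫⁻ ξ, ENNReal.ofReal (Real.exp (p ξ)) ∂N) * ∫⁻ ξ, ENNReal.ofReal (Real.exp (q ξ)) ∂N :=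
    fun p q hp hq => lintegral_prod_mul (f := fun ξ => ENNReal.ofReal (Real.exp (p ξ)))
      (g := fun ξ => ENNReal.ofReal (Real.exp (q ξ))) (by fun_prop) (by fun_prop)
  calc _ = ∫⁻ ω, ∫⁻ z, ENNReal.ofReal (Real.exp (√2 * X ω * z.1)) *
          ENNReal.ofReal (Real.exp (√2 * Y ω * z.2)) ∂(N.prod N) ∂P := by
        refine lintegral_congr fun ω => ?_
        rw [ofReal_exp_sq_eq_lintegral, ofReal_exp_sq_eq_lintegral,
          hprod (fun ξ => √2 * X ω * ξ) (fun ξ => √2 * Y ω * ξ) (by fun_prop) (by fun_prop)]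
    _ = ∫⁻ z, ENNReal.ofReal (Real.exp (a * z.1 ^ 2 + 2 * c * z.1 * z.2 + b * z.2 ^ 2))
          ∂(N.prod N) := by
        rw [lintegral_lintegral_swap (by fun_prop)]
        refine lintegral_congr fun z => ?_
        have := h (√2 * z.1) (√2 * z.2)
        convert this using 1
        · refine lintegral_congr fun ω => ?_
          rw [← ENNReal.ofReal_mul (Real.exp_pos _).le, ← Real.exp_add]
          ring_nf
        · congr 2
          have h2 : √2 * √2 = 2 := Real.mul_self_sqrt (by norm_num)
          linear_combination (-(a * z.1 ^ 2 + 2 * c * z.1 * z.2 + b * z.2 ^ 2) / 2) * h2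
    _ ≤ ∫⁻ z, (ENNReal.ofReal (Real.exp (a * z.1 ^ 2)) * ENNReal.ofReal (Real.exp (b * z.2 ^ 2)) +
          ENNReal.ofReal |c| * (16 * (ENNReal.ofReal (Real.exp (5 / 16 * z.1 ^ 2)) *
            ENNReal.ofReal (Real.exp (5 / 16 * z.2 ^ 2))))) ∂(N.prod N) := by
        refine lintegral_mono fun z => ?_
        refine (ENNReal.ofReal_le_ofReal (exp_add_le_exp_add_mul ha hb hc)).trans_eq ?_
        have h16 : (16 : ℝ≥0∞) = ENNReal.ofReal 16 := by simp
        rw [h16, ENNReal.ofReal_add (by positivity) (by positivity),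
          ENNReal.ofReal_mul (Real.exp_pos _).le, ENNReal.ofReal_mul (abs_nonneg c),
          ENNReal.ofReal_mul (by norm_num), ENNReal.ofReal_mul (Real.exp_pos _).le]
    _ = _ := by
        rw [lintegral_add_left (by fun_prop), lintegral_const_mul _ (by fun_prop),
          lintegral_const_mul _ (by fun_prop),
          hprod (fun ξ => a * ξ ^ 2) (fun ξ => b * ξ ^ 2) (by fun_prop) (by fun_prop),
          hprod (fun ξ => 5 / 16 * ξ ^ 2) (fun ξ => 5 / 16 * ξ ^ 2) (by fun_prop) (by fun_prop),
          gaussianDecorrelationConst, sq]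

end

/-! ### Almost sure boundedness from summable variances. -/

/-- `(x - m)² + 2mx = x² + m²` with `|x - m|` written as a sum of truncated differences, so that
variances can be handled in `ℝ≥0∞` before finiteness is known. -/
theorem ENNReal.sq_tsub_add_tsub_add {x m : ℝ≥0∞} :
    ((x - m) + (m - x)) ^ 2 + 2 * m * x = x ^ 2 + m ^ 2 := by
  rcases le_total m x with h | h
  · obtain ⟨d, rfl⟩ := exists_add_of_le h
    rcases eq_or_ne m ∞ with rfl | hm
    · simp
    · rw [ENNReal.add_sub_cancel_left hm, tsub_eq_zero_of_le h]
      ring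
  · obtain ⟨d, rfl⟩ := exists_add_of_le h
    rcases eq_or_ne x ∞ with rfl | hm
    · simp
    · rw [ENNReal.add_sub_cancel_left hm, tsub_eq_zero_of_le h]
      ring

/-- Random variables with bounded means and summable variances are almost surely bounded. -/
theorem ae_exists_forall_le_of_tsum_variance_lt_top {Ω : Type*} [MeasurableSpace Ω] {P : Measure Ω}
    [IsProbabilityMeasure P] {F : ℕ → Ω → ℝ≥0∞} (hF : ∀ n, Measurable (F n)) {K : ℝ≥0∞}
    (hK : K < ∞) (hmean : ∀ n, ∫⁻ ω, F n ω ∂P ≤ K) {b : ℕ → ℝ≥0∞} (hb : ∑' n, b n < ∞)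
    (hvar : ∀ n, ∫⁻ ω, F n ω ^ 2 ∂P ≤ (∫⁻ ω, F n ω ∂P) ^ 2 + b n) :
    ∀ᵐ ω ∂P, ∃ M < ∞, ∀ n, F n ω ≤ M := by
  set m : ℕ → ℝ≥0∞ := fun n => ∫⁻ ω, F n ω ∂P
  set D : ℕ → Ω → ℝ≥0∞ := fun n ω => (F n ω - m n) + (m n - F n ω) with hDdef
  have hm : ∀ n, m n ≠ ∞ := fun n => ((hmean n).trans_lt hK).ne
  have hDm : ∀ n, Measurable (D n) := fun n =>
    ((hF n).sub_const _).add ((hF n).const_sub _)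
  have hD : ∀ n, ∫⁻ ω, D n ω ^ 2 ∂P ≤ b n := by
    intro n
    have e : ∫⁻ ω, D n ω ^ 2 ∂P + 2 * m n * m n = ∫⁻ ω, F n ω ^ 2 ∂P + m n ^ 2 := by
      have : ∫⁻ ω, (D n ω ^ 2 + 2 * m n * F n ω) ∂P = ∫⁻ ω, (F n ω ^ 2 + m n ^ 2) ∂P :=
        lintegral_congr fun ω => ENNReal.sq_tsub_add_tsub_add
      rwa [lintegral_add_right _ (by fun_prop), lintegral_const_mul _ (hF n),
        lintegral_add_right _ (by fun_prop), lintegral_const, measure_univ, mul_one] at this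
    have h2 : ∫⁻ ω, D n ω ^ 2 ∂P + 2 * m n * m n ≤ b n + 2 * m n * m n := by
      rw [e]
      calc _ ≤ (m n ^ 2 + b n) + m n ^ 2 := by gcongr; exact hvar n
        _ = _ := by ring
    exact (ENNReal.add_le_add_iff_right
      (ENNReal.mul_ne_top (ENNReal.mul_ne_top (by norm_num) (hm n)) (hm n))).1 h2
  -- The sum of all squared deviations has finite expectation, so it is almost surely finite and
  -- bounds every deviation at once.
  have hsum : ∫⁻ ω, ∑' n, D n ω ^ 2 ∂P < ∞ := by
    rw [lintegral_tsum fun n => ((hDm n).pow_const 2).aemeasurable]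
    exact (ENNReal.tsum_le_tsum hD).trans_lt hb
  filter_upwards [ae_lt_top (Measurable.tsum fun n => (hDm n).pow_const 2) hsum.ne]
    with ω hω
  refine ⟨K + (1 + ∑' n, D n ω ^ 2), by simp [hK, hω], fun n => ?_⟩
  have h1 : F n ω ≤ m n + D n ω := by
    simp only [hDdef]
    exact le_tsub_add.trans (by rw [add_comm]; gcongr; exact le_self_add)
  have h2 : D n ω ≤ 1 + D n ω ^ 2 := by
    rcases le_total (D n ω) 1 with h | h
    · exact h.trans le_self_add
    · exact (le_self_pow h (by norm_num)).trans le_add_self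
  exact h1.trans (add_le_add (hmean n) (h2.trans (add_le_add_right (ENNReal.le_tsum n) _)))

section

variable {Ω : Type*} [MeasurableSpace Ω] {P : Measure Ω} [IsProbabilityMeasure P]

theorem lintegral_lintegral_exp_sq_le {S : Set ℝ} (hS : volume S ≤ 1) {X : ℝ → Ω → ℝ}
    (hX : Measurable (Function.uncurry X)) {c : ℝ → ℝ} (hc : ∀ᵐ s ∂volume.restrict S, c s ≤ 1 / 8)
    (h : ∀ᵐ s ∂volume.restrict S, HasGaussianMGF P (X s) (X s) (c s) (c s) (c s)) :
    ∫⁻ ω, (∫⁻ s in S, ENNReal.ofReal (Real.exp (X s ω ^ 2))) ∂P ≤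
      ∫⁻ x, ENNReal.ofReal (Real.exp (1 / 8 * x ^ 2)) ∂gaussianReal 0 1 := by
  set K := ∫⁻ x, ENNReal.ofReal (Real.exp (1 / 8 * x ^ 2)) ∂gaussianReal 0 1
  rw [lintegral_lintegral_swap (by fun_prop)]
  calc _ ≤ ∫⁻ s in S, K := by
        refine lintegral_mono_ae ?_
        filter_upwards [h, hc] with s hs hcs
        rw [hs.lintegral_exp_sq (by fun_prop)]
        refine lintegral_mono fun x => ENNReal.ofReal_le_ofReal (Real.exp_le_exp.2 ?_)
        gcongr
    _ ≤ K := by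
        rw [lintegral_const, Measure.restrict_apply_univ]
        exact mul_le_of_le_one_right' hS

/-- The squared integral is a double integral over `S × S`; Tonelli moves the expectation inside,
where the decorrelation inequality applies pairwise. -/
theorem lintegral_sq_lintegral_exp_sq_le {S : Set ℝ} {X : ℝ → Ω → ℝ}
    (hX : Measurable (Function.uncurry X)) {c : ℝ → ℝ → ℝ}
    (hc : ∀ᵐ s ∂volume.restrict S, ∀ᵐ t ∂volume.restrict S, |c s t| ≤ 1 / 8)
    (hc' : ∀ᵐ s ∂volume.restrict S, |c s s| ≤ 1 / 8)
    (h : ∀ᵐ s ∂volume.restrict S, ∀ᵐ t ∂volume.restrict S,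
      HasGaussianMGF P (X s) (X t) (c s s) (c t t) (c s t)) :
    ∫⁻ ω, (∫⁻ s in S, ENNReal.ofReal (Real.exp (X s ω ^ 2))) ^ 2 ∂P ≤
      (∫⁻ ω, (∫⁻ s in S, ENNReal.ofReal (Real.exp (X s ω ^ 2))) ∂P) ^ 2 +
        (∫⁻ s in S, ∫⁻ t in S, ENNReal.ofReal |c s t|) * gaussianDecorrelationConst := by
  have hmeas : Measurable fun z : ℝ × Ω => ENNReal.ofReal (Real.exp (X z.1 z.2 ^ 2)) := by fun_prop
  set m : ℝ → ℝ≥0∞ := fun s => ∫⁻ ω, ENNReal.ofReal (Real.exp (X s ω ^ 2)) ∂P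
  have hm : Measurable m := hmeas.lintegral_prod_right'
  have hsw : ∫⁻ ω, (∫⁻ s in S, ENNReal.ofReal (Real.exp (X s ω ^ 2))) ∂P = ∫⁻ s in S, m s :=
    lintegral_lintegral_swap (by fun_prop)
  rw [hsw]
  have hin : ∀ ω, Measurable fun s => ENNReal.ofReal (Real.exp (X s ω ^ 2)) := fun ω => by fun_prop
  calc _ = ∫⁻ ω, (∫⁻ s in S, ∫⁻ t in S, ENNReal.ofReal (Real.exp (X s ω ^ 2)) *
          ENNReal.ofReal (Real.exp (X t ω ^ 2))) ∂P := by
        refine lintegral_congr fun ω => ?_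
        rw [sq, ← lintegral_mul_const _ (hin ω)]
        exact lintegral_congr fun s => (lintegral_const_mul _ (hin ω)).symm
    _ = ∫⁻ s in S, ∫⁻ ω, (∫⁻ t in S, ENNReal.ofReal (Real.exp (X s ω ^ 2)) *
          ENNReal.ofReal (Real.exp (X t ω ^ 2))) ∂P := by
        refine lintegral_lintegral_swap (Measurable.aemeasurable ?_)
        have : Measurable fun z : (Ω × ℝ) × ℝ => ENNReal.ofReal (Real.exp (X z.1.2 z.1.1 ^ 2)) *
          ENNReal.ofReal (Real.exp (X z.2 z.1.1 ^ 2)) := by fun_prop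
        exact this.lintegral_prod_right'
    _ = ∫⁻ s in S, ∫⁻ t in S, ∫⁻ ω, ENNReal.ofReal (Real.exp (X s ω ^ 2)) *
          ENNReal.ofReal (Real.exp (X t ω ^ 2)) ∂P := by
        refine lintegral_congr fun s => lintegral_lintegral_swap (by fun_prop)
    _ ≤ ∫⁻ s in S, ∫⁻ t in S, (m s * m t + ENNReal.ofReal |c s t| * gaussianDecorrelationConst) := by
        refine lintegral_mono_ae ?_
        filter_upwards [hc, hc', h] with s h1 h2 h3
        refine lintegral_mono_ae ?_
        filter_upwards [h1, hc', h3] with t h1 h2' h3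
        exact h3.lintegral_exp_sq_add_sq_le (by fun_prop) (by fun_prop)
          ((le_abs_self _).trans h2) ((le_abs_self _).trans h2') h1
    _ = _ := by
        -- The constant is finite, so it leaves the integral without any measurability of `c`.
        have e : ∀ s, ∫⁻ t in S, (m s * m t + ENNReal.ofReal |c s t| * gaussianDecorrelationConst) =
            m s * (∫⁻ t in S, m t) +
              (∫⁻ t in S, ENNReal.ofReal |c s t|) * gaussianDecorrelationConst := fun s => by
          rw [lintegral_add_left (by fun_prop), lintegral_const_mul _ hm,
            lintegral_mul_const' _ _ gaussianDecorrelationConst_lt_top.ne]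
        simp_rw [e]
        rw [lintegral_add_left (by fun_prop), lintegral_mul_const _ hm, sq,
          lintegral_mul_const' _ _ gaussianDecorrelationConst_lt_top.ne]

/-- A measurable family of centered Gaussian processes with uniformly small variances and summable
total covariances has almost surely bounded square-exponential integrals. -/
theorem ae_exists_forall_lintegral_exp_sq_le {S : ℕ → Set ℝ} (hS : ∀ n, volume (S n) ≤ 1)
    {X : ℕ → ℝ → Ω → ℝ} (hX : ∀ n, Measurable (Function.uncurry (X n))) {c : ℕ → ℝ → ℝ → ℝ}
    (hc : ∀ n, ∀ s ∈ S n, ∀ t ∈ S n, |c n s t| ≤ 1 / 8) (hSm : ∀ n, MeasurableSet (S n))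
    (h : ∀ n, ∀ᵐ s ∂volume.restrict (S n), ∀ᵐ t ∂volume.restrict (S n),
      HasGaussianMGF P (X n s) (X n t) (c n s s) (c n t t) (c n s t))
    (h' : ∀ n, ∀ᵐ s ∂volume.restrict (S n),
      HasGaussianMGF P (X n s) (X n s) (c n s s) (c n s s) (c n s s))
    (hsum : ∑' n, ∫⁻ s in S n, ∫⁻ t in S n, ENNReal.ofReal |c n s t| < ∞) :
    ∀ᵐ ω ∂P, ∃ M < ∞, ∀ n, ∫⁻ s in S n, ENNReal.ofReal (Real.exp (X n s ω ^ 2)) ≤ M := by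
  have hcd : ∀ n, ∀ᵐ s ∂volume.restrict (S n), |c n s s| ≤ 1 / 8 := fun n => by
    filter_upwards [ae_restrict_mem (hSm n)] with s hs using hc n s hs s hs
  refine ae_exists_forall_le_of_tsum_variance_lt_top (fun n => ?_)
    (lintegral_exp_sq_gaussianReal_lt_top (a := 1 / 8) (by norm_num))
    (fun n => lintegral_lintegral_exp_sq_le (hS n) (hX n) (c := fun s => c n s s) ?_ (h' n)) ?_
    (fun n => lintegral_sq_lintegral_exp_sq_le (hX n) (c := c n) ?_ (hcd n) (h n))
  · have : Measurable fun z : Ω × ℝ => ENNReal.ofReal (Real.exp (X n z.2 z.1 ^ 2)) := by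
      have := hX n
      fun_prop
    exact this.lintegral_prod_right'
  · filter_upwards [hcd n] with s hs using (le_abs_self _).trans hs
  · rw [ENNReal.tsum_mul_right]
    exact ENNReal.mul_lt_top hsum gaussianDecorrelationConst_lt_top
  · filter_upwards [ae_restrict_mem (hSm n)] with s hs
    filter_upwards [ae_restrict_mem (hSm n)] with t ht using hc n s hs t ht

end

/-! ### Riesz potentials and power integrals. -/

section Riesz

theorem lintegral_Ioc_rpow {p L : ℝ} (hp : -1 < p) (hL : 0 ≤ L) :
    ∫⁻ a in Set.Ioc 0 L, ENNReal.ofReal (a ^ p) = ENNReal.ofReal (L ^ (p + 1) / (p + 1)) := by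
  have hint := (intervalIntegral.intervalIntegrable_rpow' (a := 0) (b := L) hp)
  rw [intervalIntegrable_iff_integrableOn_Ioc_of_le hL] at hint
  rw [← ofReal_integral_eq_lintegral_ofReal hint, ← intervalIntegral.integral_of_le hL,
    integral_rpow (Or.inl hp), Real.zero_rpow (by linarith), sub_zero]
  filter_upwards [ae_restrict_mem measurableSet_Ioc] with x hx
  exact Real.rpow_nonneg hx.1.le p

theorem lintegral_Ioi_rpow {p c : ℝ} (hp : p < -1) (hc : 0 < c) :
    ∫⁻ a in Set.Ioi c, ENNReal.ofReal (a ^ p) = ENNReal.ofReal (-c ^ (p + 1) / (p + 1)) := by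
  rw [← ofReal_integral_eq_lintegral_ofReal (integrableOn_Ioi_rpow_of_lt hp hc),
    integral_Ioi_rpow_of_lt hp hc]
  filter_upwards [ae_restrict_mem measurableSet_Ioi] with x hx
  exact Real.rpow_nonneg (hc.trans hx).le p

/-- A function bounded by one has a Riesz potential controlled by its integral. -/
theorem lintegral_mul_abs_sub_rpow_le {p L : ℝ} (hp : -1 < p) (hp' : p < 0) (hL : 0 < L)
    {f : ℝ → ℝ≥0∞} (hf : Measurable f) (hf1 : ∀ r, f r ≤ 1) (hfL : ∫⁻ r, f r ≤ ENNReal.ofReal (2 * L))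
    (b : ℝ) :
    ∫⁻ r, f r * ENNReal.ofReal (|r - b| ^ p) ≤
      ENNReal.ofReal ((2 / (p + 1) + 2) * L ^ (p + 1)) := by
  set G : ℝ → ℝ≥0∞ := (Set.Ioc 0 L).indicator fun r => ENNReal.ofReal (r ^ p) with hG
  have hGm : Measurable G := Measurable.indicator (by fun_prop) measurableSet_Ioc
  have hGi : ∫⁻ r, G r = ENNReal.ofReal (L ^ (p + 1) / (p + 1)) := by
    rw [lintegral_indicator measurableSet_Ioc, lintegral_Ioc_rpow hp hL.le]
  -- Within distance `L` of `b` use `f ≤ 1`; beyond it use `|r - b|^p ≤ L^p`, as `p < 0`, together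
  -- with the bound on `∫ f`.
  have hpt : ∀ r, f r * ENNReal.ofReal (|r - b| ^ p) ≤
      (G (r - b) + G (b - r)) + ENNReal.ofReal (L ^ p) * f r := by
    intro r
    rcases le_or_gt |r - b| L with h | h
    · refine le_trans ?_ le_self_add
      refine (mul_le_of_le_one_left' (hf1 r)).trans ?_
      rcases lt_trichotomy r b with hrb | rfl | hrb
      · refine le_trans ?_ le_add_self
        rw [abs_of_neg (by linarith), neg_sub] at *
        rw [hG, Set.indicator_of_mem (show b - r ∈ Set.Ioc 0 L from ⟨by linarith, h⟩)]
      -- At the singularity the convention `0 ^ p = 0` applies.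
      · simp [Real.zero_rpow hp'.ne]
      · refine le_trans ?_ le_self_add
        rw [abs_of_pos (by linarith)] at *
        rw [hG, Set.indicator_of_mem (show r - b ∈ Set.Ioc 0 L from ⟨by linarith, h⟩)]
    · refine le_trans ?_ le_add_self
      rw [mul_comm]
      refine mul_le_mul_left (ENNReal.ofReal_le_ofReal ?_) _
      exact Real.rpow_le_rpow_of_nonpos hL h.le hp'.le
  calc _ ≤ ∫⁻ r, ((G (r - b) + G (b - r)) + ENNReal.ofReal (L ^ p) * f r) := lintegral_mono hpt
    _ = (∫⁻ r, G r) + (∫⁻ r, G r) + ENNReal.ofReal (L ^ p) * ∫⁻ r, f r := by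
        rw [lintegral_add_left (by fun_prop), lintegral_add_left (by fun_prop),
          lintegral_const_mul _ hf, lintegral_sub_right_eq_self G b, lintegral_sub_left_eq_self G b]
    _ ≤ ENNReal.ofReal (L ^ (p + 1) / (p + 1)) + ENNReal.ofReal (L ^ (p + 1) / (p + 1)) +
          ENNReal.ofReal (L ^ p) * ENNReal.ofReal (2 * L) := by
        rw [hGi]
        gcongr
    _ = _ := by
        have : 0 < p + 1 := by linarith
        rw [← ENNReal.ofReal_mul (by positivity), ← ENNReal.ofReal_add (by positivity) (by positivity),
          ← ENNReal.ofReal_add (by positivity) (by positivity)]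
        congr 1
        rw [Real.rpow_add_one hL.ne']
        ring

theorem lintegral_Ioo_abs_sub_rpow_le {p : ℝ} (hp : -1 < p) (hp' : p < 0) (b : ℝ) :
    ∫⁻ r in Set.Ioo (0 : ℝ) 1, ENNReal.ofReal (|r - b| ^ p) ≤
      ENNReal.ofReal (2 / (p + 1) + 2) := by
  have h := lintegral_mul_abs_sub_rpow_le hp hp' one_pos (f := (Set.Ioo (0 : ℝ) 1).indicator 1)
    (measurable_one.indicator measurableSet_Ioo) (fun r => Set.indicator_le_self' (by simp) r)
    (by rw [lintegral_indicator_one measurableSet_Ioo]; simp) b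
  rw [Real.one_rpow, mul_one] at h
  refine le_of_eq_of_le ?_ h
  rw [← lintegral_indicator measurableSet_Ioo]
  refine lintegral_congr fun r => ?_
  by_cases hr : r ∈ Set.Ioo (0 : ℝ) 1 <;> simp [hr]

/-- Split at `x = 1/h`, where the minimum switches. Convergence at `0` uses `γ > 0`, at infinity `q
> γ`. -/
theorem lintegral_rpow_mul_min_rpow_le {γ q h : ℝ} (hγ : 0 < γ) (hq : γ < q) (hh : 0 < h) :
    ∫⁻ x in Set.Ioi (0 : ℝ), ENNReal.ofReal (x ^ (γ - 1)) * ENNReal.ofReal ((min h x⁻¹) ^ q) ≤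
      ENNReal.ofReal ((1 / γ + 1 / (q - γ)) * h ^ (q - γ)) := by
  have hh' : 0 < h⁻¹ := inv_pos.2 hh
  rw [← Set.Ioc_union_Ioi_eq_Ioi hh'.le]
  refine (lintegral_union_le _ _ _).trans ?_
  have e1 : ∫⁻ x in Set.Ioc 0 h⁻¹, ENNReal.ofReal (x ^ (γ - 1)) * ENNReal.ofReal ((min h x⁻¹) ^ q) ≤
      ENNReal.ofReal (1 / γ * h ^ (q - γ)) := by
    calc _ ≤ ∫⁻ x in Set.Ioc 0 h⁻¹, ENNReal.ofReal (x ^ (γ - 1)) * ENNReal.ofReal (h ^ q) := by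
          refine setLIntegral_mono' measurableSet_Ioc fun x hx => ?_
          have : 0 < x⁻¹ := inv_pos.2 hx.1
          have hq0 : 0 ≤ q := (hγ.trans hq).le
          gcongr
          exact min_le_left _ _
      _ = _ := by
          rw [lintegral_mul_const _ (by fun_prop), lintegral_Ioc_rpow (by linarith) hh'.le,
            ← ENNReal.ofReal_mul (by have := hγ; rw [sub_add_cancel]; positivity), sub_add_cancel,
            Real.inv_rpow hh.le, Real.rpow_sub hh]
          congr 1
          field_simp
  have e2 : ∫⁻ x in Set.Ioi h⁻¹, ENNReal.ofReal (x ^ (γ - 1)) * ENNReal.ofReal ((min h x⁻¹) ^ q) ≤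
      ENNReal.ofReal (1 / (q - γ) * h ^ (q - γ)) := by
    calc _ ≤ ∫⁻ x in Set.Ioi h⁻¹, ENNReal.ofReal (x ^ (γ - 1 - q)) := by
          refine setLIntegral_mono' measurableSet_Ioi fun x hx => ?_
          have hx0 : 0 < x := hh'.trans hx
          have : 0 < x⁻¹ := inv_pos.2 hx0
          rw [← ENNReal.ofReal_mul (by positivity), Real.rpow_sub hx0 (γ - 1), div_eq_mul_inv,
            ← Real.inv_rpow hx0.le]
          have hq0 : 0 ≤ q := (hγ.trans hq).le
          gcongr
          exact min_le_right _ _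
      _ = _ := by
          rw [lintegral_Ioi_rpow (by linarith) hh', Real.inv_rpow hh.le, ← Real.rpow_neg hh.le]
          congr 1
          have h1 : γ - 1 - q + 1 = -(q - γ) := by ring
          rw [h1, neg_neg]
          field_simp
  refine (add_le_add e1 e2).trans_eq ?_
  have : 0 < q - γ := by linarith
  rw [← ENNReal.ofReal_add (by positivity) (by positivity), add_mul]

end Riesz

/-! ### Increments of truncated exponentials. -/

section ExponentialKernel

/-- The exponential `exp (-x (t - r))` restricted to `0 < r < t`. -/
noncomputable def expWindow (x t r : ℝ) : ℝ :=
  if 0 < r ∧ r < t then Real.exp (-(x * (t - r))) else 0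

/-- A majorant of the increments over a time step `h` of `expWindow x`. -/
noncomputable def expWindowIncr (h x a : ℝ) : ℝ :=
  (Set.Ioc (-h) 0).indicator (fun a => Real.exp (-(x * (a + h)))) a +
    (Set.Ioi 0).indicator (fun a => Real.exp (-(x * a)) * min 1 (x * h)) a

theorem expWindowIncr_nonneg {h x : ℝ} (hh : 0 ≤ h) (hx : 0 < x) (a : ℝ) :
    0 ≤ expWindowIncr h x a := by
  refine add_nonneg (Set.indicator_nonneg (fun _ _ => (Real.exp_pos _).le) _)
    (Set.indicator_nonneg (fun _ _ => ?_) _)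
  have : 0 ≤ min 1 (x * h) := le_min zero_le_one (by positivity)
  positivity

theorem expWindowIncr_le_one {h x : ℝ} (hx : 0 < x) (a : ℝ) :
    expWindowIncr h x a ≤ 1 := by
  unfold expWindowIncr
  rcases le_or_gt a 0 with ha | ha
  · rw [Set.indicator_of_notMem (s := Set.Ioi 0) (by simpa using ha), add_zero]
    refine Set.indicator_le' (fun b hb => ?_) (fun _ _ => zero_le_one) a
    have : 0 < b + h := by linarith [hb.1]
    exact Real.exp_le_one_iff.2 (by nlinarith)
  · rw [Set.indicator_of_notMem (by simp [ha]), Set.indicator_of_mem (by exact ha), zero_add]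
    have h1 : Real.exp (-(x * a)) ≤ 1 := Real.exp_le_one_iff.2 (by nlinarith)
    nlinarith [min_le_left 1 (x * h), Real.exp_pos (-(x * a))]

theorem measurable_expWindowIncr (h : ℝ) : Measurable fun y : ℝ × ℝ => expWindowIncr h y.1 y.2 := by
  unfold expWindowIncr
  refine Measurable.add ?_ ?_
  · have : (fun y : ℝ × ℝ => (Set.Ioc (-h) 0).indicator (fun a => Real.exp (-(y.1 * (a + h)))) y.2) =
        (Prod.snd ⁻¹' Set.Ioc (-h) 0).indicator fun y : ℝ × ℝ => Real.exp (-(y.1 * (y.2 + h))) := by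
      ext y; rfl
    rw [this]
    exact Measurable.indicator (by fun_prop) (measurable_snd measurableSet_Ioc)
  · have : (fun y : ℝ × ℝ => (Set.Ioi 0).indicator
          (fun a => Real.exp (-(y.1 * a)) * min 1 (y.1 * h)) y.2) =
        (Prod.snd ⁻¹' Set.Ioi 0).indicator
          fun y : ℝ × ℝ => Real.exp (-(y.1 * y.2)) * min 1 (y.1 * h) := by
      ext y; rfl
    rw [this]
    exact Measurable.indicator (by fun_prop) (measurable_snd measurableSet_Ioi)

theorem lintegral_Ioi_exp_neg_mul {x : ℝ} (hx : 0 < x) :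
    ∫⁻ a in Set.Ioi (0 : ℝ), ENNReal.ofReal (Real.exp (-(x * a))) = ENNReal.ofReal x⁻¹ := by
  have h1 := integrableOn_exp_mul_Ioi (neg_lt_zero.2 hx) 0
  have h2 := integral_exp_mul_Ioi (neg_lt_zero.2 hx) 0
  simp only [neg_mul] at h1 h2
  rw [← ofReal_integral_eq_lintegral_ofReal h1 (ae_of_all _ fun _ => (Real.exp_pos _).le), h2]
  simp

/-- Each of the two pieces has mass at most `min(h, 1/x)`: the first has length `h` and is part of
an exponential of mass `1/x`; the second has mass `(1/x) min(1, xh)`. -/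
theorem lintegral_expWindowIncr_le {h x : ℝ} (hh : 0 ≤ h) (hx : 0 < x) :
    ∫⁻ a, ENNReal.ofReal (expWindowIncr h x a) ≤ ENNReal.ofReal (2 * min h x⁻¹) := by
  have hm : 0 ≤ min 1 (x * h) := le_min zero_le_one (by positivity)
  have hmin : 0 ≤ min h x⁻¹ := le_min hh (inv_nonneg.2 hx.le)
  set f : ℝ → ℝ≥0∞ := (Set.Ioc (-h) 0).indicator fun a => ENNReal.ofReal (Real.exp (-(x * (a + h))))
  set g : ℝ → ℝ≥0∞ := (Set.Ioi 0).indicator fun a =>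
    ENNReal.ofReal (Real.exp (-(x * a))) * ENNReal.ofReal (min 1 (x * h))
  have hf : Measurable f := Measurable.indicator (by fun_prop) measurableSet_Ioc
  have hpt : ∀ a, ENNReal.ofReal (expWindowIncr h x a) ≤ f a + g a := by
    intro a
    refine ENNReal.ofReal_add_le.trans (add_le_add (le_of_eq ?_) (le_of_eq ?_))
    · by_cases ha : a ∈ Set.Ioc (-h) 0 <;> simp [f, ha]
    · by_cases ha : a ∈ Set.Ioi (0 : ℝ)
      · simp only [g, Set.indicator_of_mem ha]
        rw [ENNReal.ofReal_mul (Real.exp_pos _).le]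
      · simp [g, ha]
  have hf1 : ∫⁻ a, f a ≤ ENNReal.ofReal (min h x⁻¹) := by
    rw [ENNReal.ofReal_min]
    refine le_min ?_ ?_
    · calc ∫⁻ a, f a ≤ ∫⁻ a, (Set.Ioc (-h) 0).indicator 1 a := by
            refine lintegral_mono fun a => Set.indicator_le_indicator' fun ha => ?_
            have : 0 < a + h := by linarith [ha.1]
            exact ENNReal.ofReal_le_one.2 (Real.exp_le_one_iff.2 (by nlinarith))
        _ = _ := by
            rw [lintegral_indicator_one measurableSet_Ioc, Real.volume_Ioc]
            simp
    · calc ∫⁻ a, f a ≤ ∫⁻ a, (Set.Ioi 0).indicator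
              (fun a => ENNReal.ofReal (Real.exp (-(x * a)))) (a + h) := by
            refine lintegral_mono fun a => ?_
            by_cases ha : a ∈ Set.Ioc (-h) 0
            · have : a + h ∈ Set.Ioi 0 := by simpa using by linarith [ha.1]
              simp [f, Set.indicator_of_mem ha, Set.indicator_of_mem this]
            · simp [f, ha]
        _ = _ := by
            rw [lintegral_add_right_eq_self (fun a => (Set.Ioi 0).indicator
              (fun a => ENNReal.ofReal (Real.exp (-(x * a)))) a) h,
              lintegral_indicator measurableSet_Ioi, lintegral_Ioi_exp_neg_mul hx]
  have hg1 : ∫⁻ a, g a = ENNReal.ofReal (min h x⁻¹) := by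
    rw [lintegral_indicator measurableSet_Ioi, lintegral_mul_const _ (by fun_prop),
      lintegral_Ioi_exp_neg_mul hx, ← ENNReal.ofReal_mul (by positivity)]
    congr 1
    rw [mul_min_of_nonneg _ _ (inv_nonneg.2 hx.le), mul_one, inv_mul_cancel_left₀ hx.ne', min_comm]
  calc _ ≤ ∫⁻ a, (f a + g a) := lintegral_mono hpt
    _ = (∫⁻ a, f a) + ∫⁻ a, g a := lintegral_add_left hf _
    _ ≤ ENNReal.ofReal (min h x⁻¹) + ENNReal.ofReal (min h x⁻¹) := by rw [hg1]; gcongr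
    _ = _ := by rw [← ENNReal.ofReal_add hmin hmin, two_mul]

/-- For `r < t` both windows are open and `1 - e^(-xh) ≤ min(1, xh)`; for `t ≤ r < t + h` only the
later one is; otherwise both vanish. -/
theorem abs_expWindow_sub_le {x t h : ℝ} (hx : 0 < x) (hh : 0 ≤ h) (r : ℝ) :
    |expWindow x (t + h) r - expWindow x t r| ≤ expWindowIncr h x (t - r) := by
  have hnn := expWindowIncr_nonneg hh hx (t - r)
  unfold expWindow
  by_cases h0 : 0 < r
  · rcases lt_or_ge r t with h1 | h1
    · rw [if_pos ⟨h0, by linarith⟩, if_pos ⟨h0, h1⟩, expWindowIncr,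
        Set.indicator_of_notMem (by simp [h1]), Set.indicator_of_mem (by simpa using h1), zero_add]
      have e : Real.exp (-(x * (t + h - r))) = Real.exp (-(x * (t - r))) * Real.exp (-(x * h)) := by
        rw [← Real.exp_add]; ring_nf
      rw [e, abs_sub_comm, ← mul_one_sub, abs_mul, abs_of_pos (Real.exp_pos _)]
      gcongr
      have h2 : Real.exp (-(x * h)) ≤ 1 := Real.exp_le_one_iff.2 (by nlinarith)
      rw [abs_of_nonneg (by linarith)]
      exact le_min (by linarith [Real.exp_pos (-(x * h))]) (by linarith [Real.add_one_le_exp (-(x * h))])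
    · rw [if_neg (c := 0 < r ∧ r < t) (by intro h; linarith [h.2]), sub_zero]
      rcases lt_or_ge r (t + h) with h2 | h2
      · rw [if_pos ⟨h0, h2⟩, abs_of_pos (Real.exp_pos _), expWindowIncr,
          Set.indicator_of_mem (by constructor <;> linarith), Set.indicator_of_notMem (by simpa using h1),
          add_zero]
        exact le_of_eq (by ring_nf)
      · rw [if_neg (by intro h; linarith [h.2])]
        simpa using hnn
  · rw [if_neg (by tauto), if_neg (by tauto)]
    simpa using hnn

end ExponentialKernel

theorem integral_sub_sub_add {α : Type*} [MeasurableSpace α] {μ : Measure α} {f g k l : α → ℝ}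
    (hf : Integrable f μ) (hg : Integrable g μ) (hk : Integrable k μ) (hl : Integrable l μ) :
    ∫ a, f a ∂μ - ∫ a, g a ∂μ - ∫ a, k a ∂μ + ∫ a, l a ∂μ =
      ∫ a, (f a - g a - k a + l a) ∂μ := by
  rw [integral_add (f := fun a => f a - g a - k a) ((hf.sub hg).sub hk) hl,
    integral_sub (f := fun a => f a - g a) (hf.sub hg) hk, integral_sub hf hg]

/-! ### Energy estimates for the covariance kernel. -/

section ConvolutionKernel

/-- The kernel `(t - r + s - r')^(-γ)` for `r ∈ (0, t)` and `r' ∈ (0, s)`. -/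
noncomputable def convKernel (γ t s : ℝ) (z : ℝ × ℝ) : ℝ :=
  if (0 < z.1 ∧ z.1 < t) ∧ (0 < z.2 ∧ z.2 < s) then (t - z.1 + (s - z.2)) ^ (-γ) else 0

theorem measurable_convKernel (γ t s : ℝ) : Measurable (convKernel γ t s) := by
  refine Measurable.ite ?_ (by fun_prop) measurable_const
  exact ((measurableSet_Ioo (a := (0 : ℝ)) (b := t)).prod (measurableSet_Ioo (a := (0 : ℝ)) (b := s)))

theorem convKernel_nonneg (γ t s : ℝ) (z : ℝ × ℝ) : 0 ≤ convKernel γ t s z := by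
  unfold convKernel
  split_ifs with h
  · exact Real.rpow_nonneg (by linarith [h.1.2, h.2.2]) _
  · rfl

theorem convKernel_zero_left (γ s : ℝ) (z : ℝ × ℝ) : convKernel γ 0 s z = 0 :=
  if_neg fun h => by linarith [h.1.1, h.1.2]

theorem convKernel_zero_right (γ t : ℝ) (z : ℝ × ℝ) : convKernel γ t 0 z = 0 :=
  if_neg fun h => by linarith [h.2.1, h.2.2]

/-- The Gamma integral separates the variables `r` and `r'` of the kernel. -/
theorem integrable_and_integral_expWindow {γ : ℝ} (hγ : 0 < γ) (t s : ℝ) (z : ℝ × ℝ) :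
    IntegrableOn (fun x => x ^ (γ - 1) * (expWindow x t z.1 * expWindow x s z.2)) (Set.Ioi 0) ∧
    ∫ x in Set.Ioi (0 : ℝ), x ^ (γ - 1) * (expWindow x t z.1 * expWindow x s z.2) =
      convKernel γ t s z * Real.Gamma γ := by
  unfold convKernel expWindow
  by_cases h1 : 0 < z.1 ∧ z.1 < t
  · by_cases h2 : 0 < z.2 ∧ z.2 < s
    · simp only [if_pos h1, if_pos h2, if_pos (And.intro h1 h2)]
      have hpos : 0 < t - z.1 + (s - z.2) := by linarith [h1.2, h2.2]
      have key := Real.integral_rpow_mul_exp_neg_mul_Ioi hγ hpos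
      have e : ∀ x : ℝ, x ^ (γ - 1) * (Real.exp (-(x * (t - z.1))) * Real.exp (-(x * (s - z.2)))) =
          x ^ (γ - 1) * Real.exp (-((t - z.1 + (s - z.2)) * x)) := fun x => by
        rw [← Real.exp_add]; ring_nf
      simp_rw [e]
      -- The Bochner integral of a non-integrable function is `0`, so a nonzero value certifies
      -- integrability.
      refine ⟨Integrable.of_integral_ne_zero ?_, ?_⟩
      · rw [key]
        exact (mul_pos (Real.rpow_pos_of_pos (by positivity) _) (Real.Gamma_pos_of_pos hγ)).ne'
      · rw [key, one_div, Real.inv_rpow hpos.le, Real.rpow_neg hpos.le]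
    · simp [h2]
  · simp [h1]

/-- The `γ`-energy density of the increments over the time steps `h` and `h'`. -/
noncomputable def incrDensity (γ h h' t s : ℝ) (z : ℝ × ℝ) : ℝ≥0∞ :=
  ∫⁻ x in Set.Ioi (0 : ℝ), ENNReal.ofReal (x ^ (γ - 1)) *
    (ENNReal.ofReal (expWindowIncr h x (t - z.1)) * ENNReal.ofReal (expWindowIncr h' x (s - z.2)))

/-- The `(γ, p)`-energy of the increments over the time steps `h` and `h'`. -/
noncomputable def incrEnergy (γ p h h' t s : ℝ) : ℝ≥0∞ :=
  ∫⁻ z : ℝ × ℝ, incrDensity γ h h' t s z * ENNReal.ofReal (|z.1 - z.2| ^ p)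

/-- Under the Gamma integral, the second difference of a product of functions of `t` and of `s` is
the product of their first differences. -/
theorem enorm_convKernel_secondDiff_le {γ : ℝ} (hγ : 0 < γ) {h h' : ℝ} (hh : 0 ≤ h) (hh' : 0 ≤ h')
    (t s : ℝ) (z : ℝ × ℝ) :
    ‖convKernel γ (t + h) (s + h') z - convKernel γ (t + h) s z - convKernel γ t (s + h') z +
        convKernel γ t s z‖ₑ ≤
      ENNReal.ofReal (Real.Gamma γ)⁻¹ * incrDensity γ h h' t s z := by
  have hΓ : 0 < Real.Gamma γ := Real.Gamma_pos_of_pos hγ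
  obtain ⟨i1, e1⟩ := integrable_and_integral_expWindow hγ (t + h) (s + h') z
  obtain ⟨i2, e2⟩ := integrable_and_integral_expWindow hγ (t + h) s z
  obtain ⟨i3, e3⟩ := integrable_and_integral_expWindow hγ t (s + h') z
  obtain ⟨i4, e4⟩ := integrable_and_integral_expWindow hγ t s z
  have e : convKernel γ (t + h) (s + h') z - convKernel γ (t + h) s z - convKernel γ t (s + h') z +
      convKernel γ t s z = (Real.Gamma γ)⁻¹ * ∫ x in Set.Ioi (0 : ℝ), x ^ (γ - 1) *
        ((expWindow x (t + h) z.1 - expWindow x t z.1) *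
          (expWindow x (s + h') z.2 - expWindow x s z.2)) := by
    have : ∫ x in Set.Ioi (0 : ℝ), x ^ (γ - 1) * ((expWindow x (t + h) z.1 - expWindow x t z.1) *
          (expWindow x (s + h') z.2 - expWindow x s z.2)) =
        (convKernel γ (t + h) (s + h') z - convKernel γ (t + h) s z - convKernel γ t (s + h') z +
          convKernel γ t s z) * Real.Gamma γ := by
      rw [add_mul, sub_mul, sub_mul, ← e1, ← e2, ← e3, ← e4, integral_sub_sub_add i1 i2 i3 i4]
      refine integral_congr_ae (ae_of_all _ fun x => ?_)
      simp only
      ring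
    rw [this]
    field_simp
  rw [e, enorm_mul, Real.enorm_of_nonneg (by positivity)]
  refine mul_le_mul_right ((enorm_integral_le_lintegral_enorm _).trans ?_) _
  refine setLIntegral_mono' measurableSet_Ioi fun x hx => ?_
  have hx : 0 < x := hx
  rw [enorm_mul, enorm_mul, Real.enorm_of_nonneg (by positivity)]
  have hb : ∀ {a b : ℝ}, |a| ≤ b → ‖a‖ₑ ≤ ENNReal.ofReal b := fun h => by
    rw [← ofReal_norm]
    exact ENNReal.ofReal_le_ofReal h
  gcongr
  · exact hb (abs_expWindow_sub_le hx hh _)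
  · exact hb (abs_expWindow_sub_le hx hh' _)

theorem incrEnergy_eq (γ p h h' t s : ℝ) :
    incrEnergy γ p h h' t s = ∫⁻ x in Set.Ioi (0 : ℝ), ∫⁻ r, ∫⁻ b, ENNReal.ofReal (x ^ (γ - 1)) *
      (ENNReal.ofReal (expWindowIncr h x (t - r)) * ENNReal.ofReal (expWindowIncr h' x b)) *
        ENNReal.ofReal (|s - (r + b)| ^ p) := by
  have m1 : Measurable (Function.uncurry (expWindowIncr h)) := measurable_expWindowIncr h
  have m2 : Measurable (Function.uncurry (expWindowIncr h')) := measurable_expWindowIncr h'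
  unfold incrEnergy incrDensity
  calc _ = ∫⁻ z : ℝ × ℝ, ∫⁻ x in Set.Ioi (0 : ℝ), ENNReal.ofReal (x ^ (γ - 1)) *
      (ENNReal.ofReal (expWindowIncr h x (t - z.1)) * ENNReal.ofReal (expWindowIncr h' x (s - z.2))) *
        ENNReal.ofReal (|z.1 - z.2| ^ p) :=
        lintegral_congr fun z => (lintegral_mul_const' _ _ ENNReal.ofReal_ne_top).symm
    _ = _ := by
      rw [lintegral_lintegral_swap (by fun_prop)]
      refine lintegral_congr fun x => ?_
      rw [Measure.volume_eq_prod, lintegral_prod _ (by fun_prop)]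
      refine lintegral_congr fun r => ?_
      rw [← lintegral_sub_left_eq_self _ s]
      refine lintegral_congr fun b => ?_
      simp only [sub_sub_cancel]
      rw [show s - (r + b) = -(r - (s - b)) by ring, abs_neg]

/-- For fixed `x` and `L = min(m, 1/x)`, the Riesz bound in `r'` gives `C L^(p+1)` and the mass in
`r` gives `2L`; the `x`-integral is then the case `q = p + 2`. Unequal steps are allowed so that the
kernel itself, a second difference based at `(0,0)`, is covered too. -/
theorem incrEnergy_le {γ p : ℝ} (hγ : 0 < γ) (hp : -1 < p) (hp' : p < 0) (hγp : γ < p + 2) :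
    ∃ K : ℝ, ∀ h h' m t s : ℝ, 0 ≤ h → h ≤ m → 0 ≤ h' → h' ≤ m → 0 < m →
      incrEnergy γ p h h' t s ≤ ENNReal.ofReal (K * m ^ (p + 2 - γ)) := by
  set C := 2 / (p + 1) + 2
  have hC : 0 < C := by
    have : 0 < p + 1 := by linarith
    positivity
  refine ⟨2 * C * (1 / γ + 1 / (p + 2 - γ)), fun h h' m t s hh hhm hh' hhm' hm => ?_⟩
  have m1 : Measurable (Function.uncurry (expWindowIncr h)) := measurable_expWindowIncr h
  have m2 : Measurable (Function.uncurry (expWindowIncr h')) := measurable_expWindowIncr h'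
  rw [incrEnergy_eq]
  calc _ ≤ ∫⁻ x in Set.Ioi (0 : ℝ), ENNReal.ofReal (2 * C) *
        (ENNReal.ofReal (x ^ (γ - 1)) * ENNReal.ofReal ((min m x⁻¹) ^ (p + 2))) := by
        refine setLIntegral_mono' measurableSet_Ioi fun x hx => ?_
        have hx : 0 < x := hx
        have hL : 0 < min m x⁻¹ := lt_min hm (inv_pos.2 hx)
        set L := min m x⁻¹
        have hB : ∫⁻ a, ENNReal.ofReal (expWindowIncr h x a) ≤ ENNReal.ofReal (2 * L) :=
          (lintegral_expWindowIncr_le hh hx).trans (ENNReal.ofReal_le_ofReal (by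
            simp only [L]; gcongr))
        have hB' : ∫⁻ a, ENNReal.ofReal (expWindowIncr h' x a) ≤ ENNReal.ofReal (2 * L) :=
          (lintegral_expWindowIncr_le hh' hx).trans (ENNReal.ofReal_le_ofReal (by
            simp only [L]; gcongr))
        have hin : ∀ r, ∫⁻ b, ENNReal.ofReal (expWindowIncr h' x b) *
            ENNReal.ofReal (|s - (r + b)| ^ p) ≤ ENNReal.ofReal (C * L ^ (p + 1)) := fun r => by
          have := lintegral_mul_abs_sub_rpow_le hp hp' hL
            (f := fun b => ENNReal.ofReal (expWindowIncr h' x b)) (by fun_prop)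
            (fun b => ENNReal.ofReal_le_one.2 (expWindowIncr_le_one hx b)) hB' (s - r)
          refine le_of_eq_of_le (lintegral_congr fun b => ?_) this
          rw [show s - (r + b) = -(b - (s - r)) by ring, abs_neg]
        calc _ = ∫⁻ r, ENNReal.ofReal (x ^ (γ - 1)) * ENNReal.ofReal (expWindowIncr h x (t - r)) *
              ∫⁻ b, ENNReal.ofReal (expWindowIncr h' x b) * ENNReal.ofReal (|s - (r + b)| ^ p) := by
              refine lintegral_congr fun r => ?_
              rw [← lintegral_const_mul _ (by fun_prop)]
              exact lintegral_congr fun b => by ring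
          _ ≤ ∫⁻ r, ENNReal.ofReal (x ^ (γ - 1)) * ENNReal.ofReal (expWindowIncr h x (t - r)) *
              ENNReal.ofReal (C * L ^ (p + 1)) := by
              refine lintegral_mono fun r => mul_le_mul_right (hin r) _
          _ = ENNReal.ofReal (x ^ (γ - 1)) * (∫⁻ a, ENNReal.ofReal (expWindowIncr h x a)) *
              ENNReal.ofReal (C * L ^ (p + 1)) := by
              rw [lintegral_mul_const _ (by fun_prop), lintegral_const_mul _ (by fun_prop),
                lintegral_sub_left_eq_self (fun a => ENNReal.ofReal (expWindowIncr h x a)) t]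
          _ ≤ ENNReal.ofReal (x ^ (γ - 1)) * ENNReal.ofReal (2 * L) *
              ENNReal.ofReal (C * L ^ (p + 1)) := by gcongr
          _ = _ := by
              have e : ENNReal.ofReal (2 * L) * ENNReal.ofReal (C * L ^ (p + 1)) =
                  ENNReal.ofReal (2 * C) * ENNReal.ofReal (L ^ (p + 2)) := by
                rw [← ENNReal.ofReal_mul (by positivity), ← ENNReal.ofReal_mul (by positivity)]
                congr 1
                rw [show p + 2 = p + 1 + 1 by ring, Real.rpow_add_one hL.ne' (p + 1)]
                ring
              rw [mul_assoc, e, mul_left_comm]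
    _ ≤ ENNReal.ofReal (2 * C) *
        ENNReal.ofReal ((1 / γ + 1 / (p + 2 - γ)) * m ^ (p + 2 - γ)) := by
        rw [lintegral_const_mul' _ _ ENNReal.ofReal_ne_top]
        exact mul_le_mul_right (lintegral_rpow_mul_min_rpow_le hγ hγp hm) _
    _ = _ := by
        rw [← ENNReal.ofReal_mul (by positivity), ← mul_assoc]

/-- Integrating over `s` first replaces the singular factor by the constant `C`, leaving two masses
`2L` and the case `q = 2`. Compared with `incrEnergy_le` this gains `h^(-p)`. -/
theorem lintegral_incrEnergy_le {γ p : ℝ} (hγ : 0 < γ) (hp : -1 < p) (hp' : p < 0) (hγ2 : γ < 2) :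
    ∃ K : ℝ, ∀ h t : ℝ, 0 < h →
      ∫⁻ s in Set.Ioo (0 : ℝ) 1, incrEnergy γ p h h t s ≤ ENNReal.ofReal (K * h ^ (2 - γ)) := by
  set C := 2 / (p + 1) + 2
  have hC : 0 < C := by
    have : 0 < p + 1 := by linarith
    positivity
  refine ⟨4 * C * (1 / γ + 1 / (2 - γ)), fun h t hh => ?_⟩
  have m1 : Measurable (Function.uncurry (expWindowIncr h)) := measurable_expWindowIncr h
  simp_rw [incrEnergy_eq]
  calc _ = ∫⁻ s in Set.Ioo (0 : ℝ) 1, ∫⁻ x in Set.Ioi (0 : ℝ), ∫⁻ z : ℝ × ℝ,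
          ENNReal.ofReal (x ^ (γ - 1)) * (ENNReal.ofReal (expWindowIncr h x (t - z.1)) *
            ENNReal.ofReal (expWindowIncr h x z.2)) * ENNReal.ofReal (|s - (z.1 + z.2)| ^ p) := by
        refine lintegral_congr fun s => lintegral_congr fun x => ?_
        rw [Measure.volume_eq_prod, lintegral_prod _ (by fun_prop)]
    _ = ∫⁻ x in Set.Ioi (0 : ℝ), ∫⁻ s in Set.Ioo (0 : ℝ) 1, ∫⁻ z : ℝ × ℝ,
          ENNReal.ofReal (x ^ (γ - 1)) * (ENNReal.ofReal (expWindowIncr h x (t - z.1)) *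
            ENNReal.ofReal (expWindowIncr h x z.2)) * ENNReal.ofReal (|s - (z.1 + z.2)| ^ p) := by
        refine lintegral_lintegral_swap (Measurable.aemeasurable ?_)
        have : Measurable fun y : (ℝ × ℝ) × ℝ × ℝ => ENNReal.ofReal (y.1.2 ^ (γ - 1)) *
            (ENNReal.ofReal (expWindowIncr h y.1.2 (t - y.2.1)) *
            ENNReal.ofReal (expWindowIncr h y.1.2 y.2.2)) *
              ENNReal.ofReal (|y.1.1 - (y.2.1 + y.2.2)| ^ p) := by fun_prop
        exact this.lintegral_prod_right'
    _ ≤ ∫⁻ x in Set.Ioi (0 : ℝ), ENNReal.ofReal (4 * C) *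
          (ENNReal.ofReal (x ^ (γ - 1)) * ENNReal.ofReal ((min h x⁻¹) ^ (2 : ℝ))) := by
        refine setLIntegral_mono' measurableSet_Ioi fun x hx => ?_
        have hx : 0 < x := hx
        have hL : 0 < min h x⁻¹ := lt_min hh (inv_pos.2 hx)
        have hB := lintegral_expWindowIncr_le hh.le hx
        set L := min h x⁻¹
        rw [lintegral_lintegral_swap (by fun_prop)]
        calc _ ≤ ∫⁻ z : ℝ × ℝ, ENNReal.ofReal (x ^ (γ - 1)) *
                (ENNReal.ofReal (expWindowIncr h x (t - z.1)) *
                  ENNReal.ofReal (expWindowIncr h x z.2)) * ENNReal.ofReal C := by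
              refine lintegral_mono fun z => ?_
              rw [lintegral_const_mul _ (by fun_prop)]
              exact mul_le_mul_right (lintegral_Ioo_abs_sub_rpow_le hp hp' _) _
          _ = ENNReal.ofReal (x ^ (γ - 1)) * ((∫⁻ a, ENNReal.ofReal (expWindowIncr h x a)) *
                ∫⁻ a, ENNReal.ofReal (expWindowIncr h x a)) * ENNReal.ofReal C := by
              rw [lintegral_mul_const _ (by fun_prop), lintegral_const_mul _ (by fun_prop),
                Measure.volume_eq_prod,
                lintegral_prod_mul (f := fun r => ENNReal.ofReal (expWindowIncr h x (t - r)))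
                  (g := fun b => ENNReal.ofReal (expWindowIncr h x b)) (by fun_prop) (by fun_prop),
                lintegral_sub_left_eq_self (fun a => ENNReal.ofReal (expWindowIncr h x a)) t]
          _ ≤ ENNReal.ofReal (x ^ (γ - 1)) * (ENNReal.ofReal (2 * L) * ENNReal.ofReal (2 * L)) *
                ENNReal.ofReal C := by gcongr
          _ = _ := by
              have e : ENNReal.ofReal (2 * L) * ENNReal.ofReal (2 * L) * ENNReal.ofReal C =
                  ENNReal.ofReal (4 * C) * ENNReal.ofReal (L ^ (2 : ℝ)) := by
                rw [← ENNReal.ofReal_mul (by positivity), ← ENNReal.ofReal_mul (by positivity),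
                  ← ENNReal.ofReal_mul (by positivity), Real.rpow_two]
                congr 1
                ring
              rw [mul_assoc, e, mul_left_comm]
    _ ≤ ENNReal.ofReal (4 * C) * ENNReal.ofReal ((1 / γ + 1 / (2 - γ)) * h ^ (2 - γ)) := by
        rw [lintegral_const_mul' _ _ ENNReal.ofReal_ne_top]
        exact mul_le_mul_right (lintegral_rpow_mul_min_rpow_le hγ hγ2 hh) _
    _ = _ := by
        rw [← ENNReal.ofReal_mul (by positivity), ← mul_assoc]

/-- The energy `∫∫ (t - r + s - r')^(-γ) |r - r'|^p` over `(0, t) × (0, s)`. -/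
noncomputable def convCov (γ p t s : ℝ) : ℝ :=
  ∫ z : ℝ × ℝ, convKernel γ t s z * |z.1 - z.2| ^ p

/-- The kernel vanishes when either time is `0`, so it equals its second difference from `(0,0)`
with steps `t` and `s`, and its energy is finite. -/
theorem integrable_convKernel_mul {γ p : ℝ} (hγ : 0 < γ) (hp : -1 < p) (hp' : p < 0)
    (hγp : γ < p + 2) {t s : ℝ} (ht : 0 ≤ t) (hs : 0 ≤ s) :
    Integrable fun z : ℝ × ℝ => convKernel γ t s z * |z.1 - z.2| ^ p := by
  have m := measurable_convKernel γ t s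
  refine ⟨by fun_prop, ?_⟩
  obtain ⟨K, hK⟩ := incrEnergy_le hγ hp hp' hγp
  have hE := hK t s (t + s + 1) 0 0 ht (by linarith) hs (by linarith) (by linarith)
  calc ∫⁻ z : ℝ × ℝ, ‖convKernel γ t s z * |z.1 - z.2| ^ p‖ₑ
      ≤ ∫⁻ z : ℝ × ℝ, ENNReal.ofReal (Real.Gamma γ)⁻¹ *
          (incrDensity γ t s 0 0 z * ENNReal.ofReal (|z.1 - z.2| ^ p)) := by
        refine lintegral_mono fun z => ?_
        have := enorm_convKernel_secondDiff_le hγ ht hs 0 0 z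
        simp only [zero_add, convKernel_zero_left, convKernel_zero_right, sub_zero, add_zero] at this
        rw [enorm_mul, Real.enorm_of_nonneg (Real.rpow_nonneg (abs_nonneg _) _), ← mul_assoc]
        gcongr
    _ = ENNReal.ofReal (Real.Gamma γ)⁻¹ * incrEnergy γ p t s 0 0 := by
        rw [lintegral_const_mul' _ _ ENNReal.ofReal_ne_top, incrEnergy]
    _ < ∞ := ENNReal.mul_lt_top ENNReal.ofReal_lt_top (hE.trans_lt ENNReal.ofReal_lt_top)

theorem convCov_zero_left (γ p s : ℝ) : convCov γ p 0 s = 0 := by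
  simp [convCov, convKernel_zero_left]

theorem convCov_zero_right (γ p t : ℝ) : convCov γ p t 0 = 0 := by
  simp [convCov, convKernel_zero_right]

theorem enorm_convCov_secondDiff_le {γ p : ℝ} (hγ : 0 < γ) (hp : -1 < p) (hp' : p < 0)
    (hγp : γ < p + 2) {h h' t s : ℝ} (hh : 0 ≤ h) (hh' : 0 ≤ h') (ht : 0 ≤ t) (hs : 0 ≤ s) :
    ‖convCov γ p (t + h) (s + h') - convCov γ p (t + h) s - convCov γ p t (s + h') +
        convCov γ p t s‖ₑ ≤ ENNReal.ofReal (Real.Gamma γ)⁻¹ * incrEnergy γ p h h' t s := by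
  have hth : 0 ≤ t + h := by positivity
  have hsh : 0 ≤ s + h' := by positivity
  have i1 := integrable_convKernel_mul hγ hp hp' hγp hth hsh
  have i2 := integrable_convKernel_mul hγ hp hp' hγp hth hs
  have i3 := integrable_convKernel_mul hγ hp hp' hγp ht hsh
  have i4 := integrable_convKernel_mul hγ hp hp' hγp ht hs
  unfold convCov
  rw [integral_sub_sub_add i1 i2 i3 i4]
  refine (enorm_integral_le_lintegral_enorm _).trans ?_
  rw [incrEnergy, ← lintegral_const_mul' _ _ ENNReal.ofReal_ne_top]
  refine lintegral_mono fun z => ?_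
  rw [← sub_mul, ← sub_mul, ← add_mul, enorm_mul,
    Real.enorm_of_nonneg (Real.rpow_nonneg (abs_nonneg _) _), ← mul_assoc]
  gcongr
  exact enorm_convKernel_secondDiff_le hγ hh hh' t s z

end ConvolutionKernel

/-! ### Integrals of `|r - r'|^p` over rectangles. -/

section RieszRectangle

variable {p : ℝ}

theorem hasDerivAt_abs_rpow_mul_self (p : ℝ) {y : ℝ} (hy : y ≠ 0) :
    HasDerivAt (fun y : ℝ => |y| ^ p * y) ((p + 1) * |y| ^ p) y := by
  have h := ((hasDerivAt_abs hy).rpow_const (p := p) (Or.inl (abs_ne_zero.2 hy))).mul (hasDerivAt_id y)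
  refine h.congr_deriv ?_
  have hs : (SignType.sign y : ℝ) * y = |y| := sign_mul_self y
  have hp : |y| ^ p = |y| ^ (p - 1) * |y| := by
    rw [← Real.rpow_add_one (abs_ne_zero.2 hy), sub_add_cancel]
  simp only [id, mul_one]
  rw [hp]
  linear_combination p * |y| ^ (p - 1) * hs

theorem hasDerivAt_abs_rpow_add_two (hp : -1 < p) (y : ℝ) :
    HasDerivAt (fun y : ℝ => |y| ^ (p + 2)) ((p + 2) * (|y| ^ p * y)) y := by
  convert hasDerivAt_abs_rpow y (p := p + 2) (by linarith) using 1
  rw [add_sub_cancel_right, mul_assoc]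

/-- Since `p + 1 > 0`, this antiderivative remains continuous at `0`, where its derivative blows up
for `p < 0`. -/
theorem continuous_abs_rpow_mul_self (hp : -1 < p) : Continuous fun y : ℝ => |y| ^ p * y := by
  refine continuous_iff_continuousAt.2 fun y => ?_
  rcases eq_or_ne y 0 with rfl | hy
  · have hb : ∀ y : ℝ, |(|y| ^ p * y)| ≤ |y| ^ (p + 1) := fun y => by
      rw [abs_mul, abs_of_nonneg (Real.rpow_nonneg (abs_nonneg y) p)]
      rcases eq_or_ne y 0 with rfl | hy
      · simp [Real.zero_rpow (show p + 1 ≠ 0 by linarith)]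
      · rw [Real.rpow_add_one (abs_ne_zero.2 hy)]
    have hc : Tendsto (fun y : ℝ => |y| ^ (p + 1)) (𝓝 0) (𝓝 0) := by
      have : Continuous fun y : ℝ => |y| ^ (p + 1) :=
        continuous_abs.rpow_const fun _ => Or.inr (by linarith)
      simpa [Real.zero_rpow (show p + 1 ≠ 0 by linarith)] using this.tendsto 0
    unfold ContinuousAt
    simp only [mul_zero]
    exact squeeze_zero_norm hb hc
  · exact (hasDerivAt_abs_rpow_mul_self p hy).continuousAt

theorem lintegral_Ico_abs_sub_rpow_lt_top (hp : -1 < p) (hp' : p < 0) (a b : ℝ) :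
    ∃ K : ℝ, ∀ x, ∫⁻ r in Set.Ico a b, ENNReal.ofReal (|x - r| ^ p) ≤ ENNReal.ofReal K := by
  set L := |b - a| + 1
  have hL : 0 < L := by positivity
  refine ⟨(2 / (p + 1) + 2) * L ^ (p + 1), fun x => ?_⟩
  have h := lintegral_mul_abs_sub_rpow_le hp hp' hL (f := (Set.Ico a b).indicator 1)
    (measurable_one.indicator measurableSet_Ico) (fun r => Set.indicator_le_self' (by simp) r)
    (by
      rw [lintegral_indicator_one measurableSet_Ico, Real.volume_Ico]
      refine ENNReal.ofReal_le_ofReal ?_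
      simp only [L]
      linarith [le_abs_self (b - a), abs_nonneg (b - a)]) x
  refine le_of_eq_of_le ?_ h
  rw [← lintegral_indicator measurableSet_Ico]
  refine lintegral_congr fun r => ?_
  rw [abs_sub_comm]
  by_cases hr : r ∈ Set.Ico a b <;> simp [hr]

theorem integrableOn_Ico_abs_sub_rpow (hp : -1 < p) (hp' : p < 0) (a b x : ℝ) :
    IntegrableOn (fun r : ℝ => |x - r| ^ p) (Set.Ico a b) := by
  obtain ⟨K, hK⟩ := lintegral_Ico_abs_sub_rpow_lt_top hp hp' a b
  refine ⟨Measurable.aestronglyMeasurable (by fun_prop), lt_of_eq_of_lt (lintegral_congr fun r => ?_)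
    ((hK x).trans_lt ENNReal.ofReal_lt_top)⟩
  rw [Real.enorm_of_nonneg (Real.rpow_nonneg (abs_nonneg _) _)]

theorem integrableOn_rectangle_abs_sub_rpow (hp : -1 < p) (hp' : p < 0) (a b a' b' : ℝ) :
    IntegrableOn (fun z : ℝ × ℝ => |z.1 - z.2| ^ p) (Set.Ico a b ×ˢ Set.Ico a' b') := by
  obtain ⟨K, hK⟩ := lintegral_Ico_abs_sub_rpow_lt_top hp hp' a' b'
  refine ⟨Measurable.aestronglyMeasurable (by fun_prop), ?_⟩
  rw [Measure.volume_eq_prod, ← Measure.prod_restrict]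
  unfold HasFiniteIntegral
  rw [lintegral_prod _ (by fun_prop)]
  calc _ ≤ ∫⁻ _ in Set.Ico a b, ENNReal.ofReal K := by
        refine lintegral_mono fun x => le_of_eq_of_le (lintegral_congr fun r => ?_) (hK x)
        rw [Real.enorm_of_nonneg (Real.rpow_nonneg (abs_nonneg _) _)]
    _ < ∞ := by
        rw [lintegral_const]
        exact ENNReal.mul_lt_top ENNReal.ofReal_lt_top (by simp)

/-- Two successive antiderivatives: `|y|^p y`, valid off the single point `r = x`, and then
`|y|^(p+2)`, valid everywhere. -/
theorem setIntegral_rectangle_abs_sub_rpow (hp : -1 < p) (hp' : p < 0) {a b a' b' : ℝ} (hab : a ≤ b)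
    (hab' : a' ≤ b') :
    (p + 2) * (p + 1) * ∫ z in Set.Ico a b ×ˢ Set.Ico a' b', |z.1 - z.2| ^ p =
      |b - a'| ^ (p + 2) - |a - a'| ^ (p + 2) - |b - b'| ^ (p + 2) + |a - b'| ^ (p + 2) := by
  have hcont := continuous_abs_rpow_mul_self hp
  have hinner : ∀ x : ℝ, (p + 1) * ∫ r in Set.Ico a' b', |x - r| ^ p =
      |x - a'| ^ p * (x - a') - |x - b'| ^ p * (x - b') := by
    intro x
    rw [setIntegral_congr_set Ico_ae_eq_Ioc, ← intervalIntegral.integral_of_le hab',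
      ← intervalIntegral.integral_const_mul]
    have hint : IntervalIntegrable (fun r : ℝ => (p + 1) * |x - r| ^ p) volume a' b' := by
      refine IntervalIntegrable.const_mul ?_ _
      rw [intervalIntegrable_iff_integrableOn_Ico_of_le hab']
      exact integrableOn_Ico_abs_sub_rpow hp hp' a' b' x
    rw [integral_eq_of_hasDerivAt_off_countable (fun r => -(|x - r| ^ p * (x - r)))
      (fun r => (p + 1) * |x - r| ^ p) (Set.countable_singleton x) ?_ ?_ hint]
    · ring
    · exact (hcont.comp (continuous_const.sub continuous_id)).neg.continuousOn
    · intro r hr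
      have hne : x - r ≠ 0 := sub_ne_zero.2 fun h => hr.2 (by simp [h])
      have h1 := (hasDerivAt_abs_rpow_mul_self p hne).comp_const_sub x r
      exact h1.fun_neg.congr_deriv (by ring)
  have houter : ∀ c : ℝ, ∫ x in Set.Ico a b, (p + 2) * (|x - c| ^ p * (x - c)) =
      |b - c| ^ (p + 2) - |a - c| ^ (p + 2) := by
    intro c
    rw [setIntegral_congr_set Ico_ae_eq_Ioc, ← intervalIntegral.integral_of_le hab]
    have hc : Continuous fun x : ℝ => (p + 2) * (|x - c| ^ p * (x - c)) :=
      continuous_const.mul (hcont.comp (continuous_id.sub continuous_const))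
    exact intervalIntegral.integral_eq_sub_of_hasDerivAt (f := fun x => |x - c| ^ (p + 2))
      (fun x _ => (hasDerivAt_abs_rpow_add_two hp (x - c)).comp_sub_const x c)
      (hc.intervalIntegrable _ _)
  have hi : ∀ c : ℝ, IntegrableOn (fun x : ℝ => (p + 2) * (|x - c| ^ p * (x - c))) (Set.Ico a b) :=
    fun c => by
      have hc : Continuous fun x : ℝ => (p + 2) * (|x - c| ^ p * (x - c)) :=
        continuous_const.mul (hcont.comp (continuous_id.sub continuous_const))
      exact (hc.integrableOn_Icc).mono_set Set.Ico_subset_Icc_self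
  have hrect := integrableOn_rectangle_abs_sub_rpow hp hp' a b a' b'
  rw [Measure.volume_eq_prod] at hrect ⊢
  rw [setIntegral_prod _ hrect, mul_assoc, ← integral_const_mul, ← integral_const_mul]
  simp_rw [hinner, fun x : ℝ => mul_sub (p + 2) (|x - a'| ^ p * (x - a')) (|x - b'| ^ p * (x - b'))]
  rw [integral_sub (hi a') (hi b'), houter, houter]
  ring

end RieszRectangle

/-! ### Covariances of increments of the driving processes. -/

section GaussianProcess

variable {Ω : Type*} [MeasurableSpace Ω] {P : Measure Ω} {T : Set ℝ} {C : ℝ → ℝ → ℝ}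
  {X : ℝ → Ω → ℝ}

theorem IsCenteredGaussianOn.memLp_two (h : IsCenteredGaussianOn T C X P) {t : ℝ} (ht : t ∈ T) :
    MemLp (X t) 2 P :=
  (h.gaussian.hasGaussianLaw_eval ⟨t, ht⟩).memLp_two

theorem IsCenteredGaussianOn.integrable_mul (h : IsCenteredGaussianOn T C X P) {t s : ℝ}
    (ht : t ∈ T) (hs : s ∈ T) : Integrable (fun ω => X t ω * X s ω) P :=
  (h.memLp_two ht).integrable_mul (h.memLp_two hs)

theorem IsCenteredGaussianOn.integral_increment_mul (h : IsCenteredGaussianOn T C X P)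
    {a b c d : ℝ} (ha : a ∈ T) (hb : b ∈ T) (hc : c ∈ T) (hd : d ∈ T) :
    ∫ ω, (X b ω - X a ω) * (X d ω - X c ω) ∂P = C b d - C b c - C a d + C a c := by
  rw [← h.covariance b hb d hd, ← h.covariance b hb c hc, ← h.covariance a ha d hd,
    ← h.covariance a ha c hc, integral_sub_sub_add (h.integrable_mul hb hd) (h.integrable_mul hb hc)
      (h.integrable_mul ha hd) (h.integrable_mul ha hc)]
  exact integral_congr_ae (ae_of_all _ fun ω => by ring)

/-- The one-variable powers cancel, leaving half a second difference of `|·|^(2H)`, which is the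
rectangle integral at `p = 2H - 2`. -/
theorem IsFractionalBrownianMotion.integral_increment_mul {H : ℝ} (hH : 1 / 2 < H) (hH' : H < 1)
    (h : IsFractionalBrownianMotion H X P) {a b a' b' : ℝ} (ha : 0 ≤ a) (hab : a ≤ b)
    (ha' : 0 ≤ a') (hab' : a' ≤ b') :
    ∫ ω, (X b ω - X a ω) * (X b' ω - X a' ω) ∂P =
      H * (2 * H - 1) *
        ∫ z in Set.Ico a b ×ˢ Set.Ico a' b', |z.1 - z.2| ^ (2 * H - 2) := by
  rw [IsCenteredGaussianOn.integral_increment_mul h (a := a) (b := b) (c := a') (d := b') ha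
    (ha.trans hab) ha' (ha'.trans hab')]
  have key := setIntegral_rectangle_abs_sub_rpow (p := 2 * H - 2) (by linarith) (by linarith) hab hab'
  rw [show 2 * H - 2 + 2 = 2 * H by ring, show 2 * H - 2 + 1 = 2 * H - 1 by ring] at key
  linear_combination (-1 / 2) * key

end GaussianProcess

/-! ### Discretization of the kernel along uniform partitions. -/

section RiemannSums

/-- The points `t i / N` of the uniform partition of `[0, t]` into `N` intervals. -/
noncomputable def uniformPoint (t : ℝ) (N i : ℕ) : ℝ := t * i / N

theorem uniformPoint_succ_sub {t : ℝ} {N : ℕ} (i : ℕ) :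
    uniformPoint t N (i + 1) - uniformPoint t N i = t / N := by
  unfold uniformPoint
  push_cast
  ring

theorem uniformPoint_nonneg {t : ℝ} (ht : 0 ≤ t) (N i : ℕ) : 0 ≤ uniformPoint t N i := by
  unfold uniformPoint
  positivity

theorem uniformPoint_le_succ {t : ℝ} (ht : 0 ≤ t) (N i : ℕ) :
    uniformPoint t N i ≤ uniformPoint t N (i + 1) := by
  have := uniformPoint_succ_sub (t := t) (N := N) i
  have : 0 ≤ t / N := by positivity
  linarith

theorem uniformPoint_lt {t : ℝ} (ht : 0 < t) {N i : ℕ} (hi : i < N) : uniformPoint t N i < t := by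
  have hN : (0 : ℝ) < N := by exact_mod_cast Nat.zero_lt_of_lt hi
  unfold uniformPoint
  rw [div_lt_iff₀ hN]
  exact mul_lt_mul_of_pos_left (by exact_mod_cast hi) ht

theorem uniformPoint_floor_le {t y : ℝ} (ht : 0 < t) (hy : 0 ≤ y) {N : ℕ} (hN : 0 < N) :
    uniformPoint t N ⌊y / t * N⌋₊ ≤ y := by
  have hN : (0 : ℝ) < N := by exact_mod_cast hN
  unfold uniformPoint
  rw [div_le_iff₀ hN]
  have := Nat.floor_le (show 0 ≤ y / t * N by positivity)
  calc t * ⌊y / t * N⌋₊ ≤ t * (y / t * N) := by gcongr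
    _ = y * N := by field_simp

theorem tendsto_uniformPoint_floor {t y : ℝ} (ht : 0 < t) (hy : 0 ≤ y) :
    Tendsto (fun n : ℕ => uniformPoint t (n + 1) ⌊y / t * (n + 1 : ℕ)⌋₊) atTop (𝓝 y) := by
  have h1 := ((tendsto_nat_floor_mul_div_atTop (R := ℝ) (a := y / t) (by positivity)).comp
    (tendsto_natCast_atTop_atTop (R := ℝ))).comp (tendsto_add_atTop_nat 1)
  have h2 := h1.const_mul t
  rw [mul_div_cancel₀ _ ht.ne'] at h2
  refine h2.congr fun n => ?_
  simp only [Function.comp, uniformPoint]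
  ring

theorem mem_Ico_uniformPoint_iff {t y : ℝ} (ht : 0 < t) {N i : ℕ} (hN : 0 < N) :
    y ∈ Set.Ico (uniformPoint t N i) (uniformPoint t N (i + 1)) ↔ 0 ≤ y ∧ ⌊y / t * N⌋₊ = i := by
  have hN : (0 : ℝ) < N := by exact_mod_cast hN
  have e : ∀ k : ℕ, uniformPoint t N k ≤ y ↔ (k : ℝ) ≤ y / t * N := fun k => by
    unfold uniformPoint
    rw [div_le_iff₀ hN, div_mul_eq_mul_div, le_div_iff₀ ht, mul_comm]
  rw [Set.mem_Ico, ← not_le, e, e]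
  constructor
  · rintro ⟨h1, h2⟩
    have hy : 0 ≤ y := (uniformPoint_nonneg ht.le N i).trans ((e i).2 h1)
    refine ⟨hy, (Nat.floor_eq_iff (by positivity)).2 ⟨h1, ?_⟩⟩
    push_cast at h2
    exact not_le.1 h2
  · rintro ⟨hy, h⟩
    obtain ⟨h1, h2⟩ := (Nat.floor_eq_iff (by positivity)).1 h
    refine ⟨h1, not_le.2 ?_⟩
    push_cast
    exact h2

theorem sum_indicator_uniformPoint {t : ℝ} (ht : 0 < t) {N : ℕ} (hN : 0 < N) (a : ℕ → ℝ) (y : ℝ) :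
    ∑ i ∈ Finset.range N,
        (Set.Ico (uniformPoint t N i) (uniformPoint t N (i + 1))).indicator (fun _ => a i) y =
      (Set.Ico 0 t).indicator (fun y => a ⌊y / t * N⌋₊) y := by
  have hN' : (0 : ℝ) < N := by exact_mod_cast hN
  simp_rw [Set.indicator_apply, mem_Ico_uniformPoint_iff ht hN, Set.mem_Ico]
  by_cases hy : 0 ≤ y
  · simp only [hy, true_and]
    rw [Finset.sum_ite_eq]
    refine if_congr ?_ rfl rfl
    rw [Finset.mem_range, Nat.floor_lt (by positivity), div_mul_eq_mul_div, div_lt_iff₀ ht, mul_comm,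
      mul_lt_mul_iff_right₀ hN']
  · simp [hy]

/-- The discretization of `convKernel` along uniform partitions. -/
noncomputable def stepKernel (γ t s : ℝ) (N : ℕ) (z : ℝ × ℝ) : ℝ :=
  ∑ i ∈ Finset.range N, ∑ j ∈ Finset.range N,
    (Set.Ico (uniformPoint t N i) (uniformPoint t N (i + 1)) ×ˢ
      Set.Ico (uniformPoint s N j) (uniformPoint s N (j + 1))).indicator
        (fun _ => (t - uniformPoint t N i + (s - uniformPoint s N j)) ^ (-γ)) z

theorem stepKernel_eq (γ : ℝ) {t s : ℝ} (ht : 0 < t) (hs : 0 < s) {N : ℕ} (hN : 0 < N) (z : ℝ × ℝ) :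
    stepKernel γ t s N z = (Set.Ico 0 t ×ˢ Set.Ico 0 s).indicator (fun z =>
      (t - uniformPoint t N ⌊z.1 / t * N⌋₊ + (s - uniformPoint s N ⌊z.2 / s * N⌋₊)) ^ (-γ)) z := by
  have hprod : ∀ (A B : Set ℝ) (f : ℝ × ℝ → ℝ), (A ×ˢ B).indicator f z =
      A.indicator (fun x => B.indicator (fun y => f (x, y)) z.2) z.1 := by
    intro A B f
    by_cases h1 : z.1 ∈ A <;> by_cases h2 : z.2 ∈ B <;> simp [Set.mem_prod, h1, h2]
  unfold stepKernel
  simp_rw [hprod]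
  rw [← sum_indicator_uniformPoint ht hN (fun i => (Set.Ico 0 s).indicator (fun y =>
    (t - uniformPoint t N i + (s - uniformPoint s N ⌊y / s * N⌋₊)) ^ (-γ)) z.2)]
  refine Finset.sum_congr rfl fun i _ => ?_
  rw [← sum_indicator_uniformPoint hs hN
    (fun j => (t - uniformPoint t N i + (s - uniformPoint s N j)) ^ (-γ))]
  by_cases h : z.1 ∈ Set.Ico (uniformPoint t N i) (uniformPoint t N (i + 1)) <;> simp [h]

/-- Left endpoints enlarge the base, and the exponent is negative, so the step kernel lies below the
kernel. The axes are excluded because the cells contain their left endpoints while the kernel lives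
on open intervals. -/
theorem stepKernel_nonneg_and_le {γ t s : ℝ} (hγ : 0 < γ) (ht : 0 < t) (hs : 0 < s) {N : ℕ}
    (hN : 0 < N) {z : ℝ × ℝ} (h1 : z.1 ≠ 0) (h2 : z.2 ≠ 0) :
    0 ≤ stepKernel γ t s N z ∧ stepKernel γ t s N z ≤ convKernel γ t s z := by
  rw [stepKernel_eq γ ht hs hN]
  by_cases hz : z ∈ Set.Ico 0 t ×ˢ Set.Ico 0 s
  · obtain ⟨⟨a1, a2⟩, a3, a4⟩ := id hz
    have b1 := uniformPoint_floor_le ht a1 hN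
    have b2 := uniformPoint_floor_le hs a3 hN
    rw [Set.indicator_of_mem hz, convKernel,
      if_pos ⟨⟨lt_of_le_of_ne a1 h1.symm, a2⟩, lt_of_le_of_ne a3 h2.symm, a4⟩]
    exact ⟨Real.rpow_nonneg (by linarith) _,
      Real.rpow_le_rpow_of_nonpos (by linarith) (by linarith) (by linarith)⟩
  · rw [Set.indicator_of_notMem hz]
    exact ⟨le_rfl, convKernel_nonneg _ _ _ _⟩

theorem tendsto_stepKernel (γ : ℝ) {t s : ℝ} (ht : 0 < t) (hs : 0 < s) {z : ℝ × ℝ}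
    (h1 : z.1 ≠ 0) (h2 : z.2 ≠ 0) :
    Tendsto (fun n : ℕ => stepKernel γ t s (n + 1) z) atTop (𝓝 (convKernel γ t s z)) := by
  simp_rw [fun n : ℕ => stepKernel_eq γ ht hs n.succ_pos z]
  by_cases hz : z ∈ Set.Ico 0 t ×ˢ Set.Ico 0 s
  · obtain ⟨⟨a1, a2⟩, a3, a4⟩ := id hz
    simp_rw [Set.indicator_of_mem hz]
    rw [convKernel, if_pos ⟨⟨lt_of_le_of_ne a1 h1.symm, a2⟩, lt_of_le_of_ne a3 h2.symm, a4⟩]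
    refine Tendsto.rpow_const ?_ (Or.inl (by linarith))
    exact (tendsto_const_nhds.sub (tendsto_uniformPoint_floor ht a1)).add
      (tendsto_const_nhds.sub (tendsto_uniformPoint_floor hs a3))
  · simp_rw [Set.indicator_of_notMem hz]
    rw [convKernel, if_neg]
    · exact tendsto_const_nhds
    · rintro ⟨⟨a1, a2⟩, a3, a4⟩
      exact hz ⟨⟨a1.le, a2⟩, a3.le, a4⟩

theorem measurable_stepKernel (γ t s : ℝ) (N : ℕ) : Measurable (stepKernel γ t s N) := by
  unfold stepKernel
  refine Finset.measurable_fun_sum _ fun i _ => Finset.measurable_fun_sum _ fun j _ => ?_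
  exact measurable_const.indicator (measurableSet_Ico.prod measurableSet_Ico)

/-- Dominated convergence with the limit kernel itself as majorant. -/
theorem tendsto_integral_stepKernel {γ p : ℝ} (hγ : 0 < γ) (hp : -1 < p) (hp' : p < 0)
    (hγp : γ < p + 2) {t s : ℝ} (ht : 0 < t) (hs : 0 < s) :
    Tendsto (fun n : ℕ => ∫ z : ℝ × ℝ, stepKernel γ t s (n + 1) z * |z.1 - z.2| ^ p) atTop
      (𝓝 (convCov γ p t s)) := by
  have hz1 : ∀ᵐ z : ℝ × ℝ, z.1 ≠ 0 :=
    (Measure.quasiMeasurePreserving_fst (μ := volume) (ν := volume)).ae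
      (Measure.ae_ne volume (0 : ℝ))
  have hz2 : ∀ᵐ z : ℝ × ℝ, z.2 ≠ 0 :=
    (Measure.quasiMeasurePreserving_snd (μ := volume) (ν := volume)).ae
      (Measure.ae_ne volume (0 : ℝ))
  refine tendsto_integral_of_dominated_convergence _ (fun n => ?_)
    (integrable_convKernel_mul hγ hp hp' hγp ht.le hs.le) (fun n => ?_) ?_
  · have := measurable_stepKernel γ t s (n + 1)
    exact Measurable.aestronglyMeasurable (by fun_prop)
  · filter_upwards [hz1, hz2] with z h1 h2
    obtain ⟨a, b⟩ := stepKernel_nonneg_and_le hγ ht hs n.succ_pos h1 h2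
    have : 0 ≤ |z.1 - z.2| ^ p := Real.rpow_nonneg (abs_nonneg _) _
    rw [Real.norm_of_nonneg (mul_nonneg a this)]
    gcongr
  · filter_upwards [hz1, hz2] with z h1 h2
    exact (tendsto_stepKernel γ ht hs h1 h2).mul_const _

end RiemannSums

/-! ### Covariance of the stochastic convolution. -/

section Covariance

variable {Ω : Type*} [MeasurableSpace Ω] {P : Measure Ω} {H γ : ℝ} {B Z : ℝ → Ω → ℝ}

theorem IndepFun.of_process (hZB : IndepFun (fun ω (t : Set.Ioi (0 : ℝ)) => Z t ω)
      (fun ω (t : Set.Ici (0 : ℝ)) => B t ω) P) {a b u u' v v' : ℝ} (ha : 0 < a) (hb : 0 < b)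
    (hu : 0 ≤ u) (hu' : 0 ≤ u') (hv : 0 ≤ v) (hv' : 0 ≤ v') :
    IndepFun (fun ω => Z a ω * Z b ω) (fun ω => (B u' ω - B u ω) * (B v' ω - B v ω)) P :=
  hZB.comp (φ := fun f : Set.Ioi (0 : ℝ) → ℝ => f ⟨a, ha⟩ * f ⟨b, hb⟩)
    (ψ := fun f : Set.Ici (0 : ℝ) → ℝ =>
      (f ⟨u', hu'⟩ - f ⟨u, hu⟩) * (f ⟨v', hv'⟩ - f ⟨v, hv⟩)) (by fun_prop) (by fun_prop)

/-- The square is a product of independent integrable variables, so no fourth moments are needed. -/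
theorem memLp_two_mul_increment (hB : IsFractionalBrownianMotion H B P)
    (hZ : IsCenteredGaussianOn (Set.Ioi 0) (fun t s => (t + s) ^ (-γ)) Z P)
    (hZB : IndepFun (fun ω (t : Set.Ioi (0 : ℝ)) => Z t ω) (fun ω (t : Set.Ici (0 : ℝ)) => B t ω) P)
    {a u u' : ℝ} (ha : 0 < a) (hu : 0 ≤ u) (hu' : 0 ≤ u') :
    MemLp (fun ω => Z a ω * (B u' ω - B u ω)) 2 P := by
  have mZ := hZ.memLp_two (t := a) ha
  have mB := (IsCenteredGaussianOn.memLp_two hB (t := u') hu').sub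
    (IsCenteredGaussianOn.memLp_two hB (t := u) hu)
  refine (memLp_two_iff_integrable_sq (mZ.1.mul mB.1)).2 ?_
  refine (IndepFun.integrable_mul (IndepFun.of_process hZB ha ha hu hu' hu hu')
    (mZ.integrable_mul mZ) (mB.integrable_mul mB)).congr (ae_of_all _ fun ω => ?_)
  simp only [Pi.mul_apply, Pi.sub_apply]
  ring

theorem memLp_two_convolutionSum (hB : IsFractionalBrownianMotion H B P)
    (hZ : IsCenteredGaussianOn (Set.Ioi 0) (fun t s => (t + s) ^ (-γ)) Z P)
    (hZB : IndepFun (fun ω (t : Set.Ioi (0 : ℝ)) => Z t ω) (fun ω (t : Set.Ici (0 : ℝ)) => B t ω) P)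
    {t : ℝ} (ht : 0 < t) (N : ℕ) :
    MemLp (convolutionSum Z B t N (uniformPoint t N)) 2 P := by
  refine memLp_finsetSum _ fun i hi => ?_
  exact memLp_two_mul_increment hB hZ hZB
    (sub_pos.2 (uniformPoint_lt ht (Finset.mem_range.1 hi)))
    (uniformPoint_nonneg ht.le N i) (uniformPoint_nonneg ht.le N (i + 1))

/-- Independence splits each term: the `Z` factor gives the value of the step kernel on a cell, the
`B` factor the integral of `|r - r'|^(2H-2)` over that cell. -/
theorem integral_convolutionSum_mul (hH : 1 / 2 < H) (hH' : H < 1)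
    (hB : IsFractionalBrownianMotion H B P)
    (hZ : IsCenteredGaussianOn (Set.Ioi 0) (fun t s => (t + s) ^ (-γ)) Z P)
    (hZB : IndepFun (fun ω (t : Set.Ioi (0 : ℝ)) => Z t ω) (fun ω (t : Set.Ici (0 : ℝ)) => B t ω) P)
    {t s : ℝ} (ht : 0 < t) (hs : 0 < s) (N : ℕ) :
    ∫ ω, convolutionSum Z B t N (uniformPoint t N) ω *
        convolutionSum Z B s N (uniformPoint s N) ω ∂P =
      H * (2 * H - 1) * ∫ z : ℝ × ℝ, stepKernel γ t s N z * |z.1 - z.2| ^ (2 * H - 2) := by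
  have hcell : ∀ i j, IntegrableOn (fun z : ℝ × ℝ => |z.1 - z.2| ^ (2 * H - 2))
      (Set.Ico (uniformPoint t N i) (uniformPoint t N (i + 1)) ×ˢ
        Set.Ico (uniformPoint s N j) (uniformPoint s N (j + 1))) := fun i j =>
    integrableOn_rectangle_abs_sub_rpow (by linarith) (by linarith) _ _ _ _
  have hmeas : ∀ i j, MeasurableSet (Set.Ico (uniformPoint t N i) (uniformPoint t N (i + 1)) ×ˢ
      Set.Ico (uniformPoint s N j) (uniformPoint s N (j + 1))) := fun i j =>
    measurableSet_Ico.prod measurableSet_Ico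
  have hR : ∀ z : ℝ × ℝ, stepKernel γ t s N z * |z.1 - z.2| ^ (2 * H - 2) =
      ∑ i ∈ Finset.range N, ∑ j ∈ Finset.range N,
        (t - uniformPoint t N i + (s - uniformPoint s N j)) ^ (-γ) *
        (Set.Ico (uniformPoint t N i) (uniformPoint t N (i + 1)) ×ˢ
          Set.Ico (uniformPoint s N j) (uniformPoint s N (j + 1))).indicator
            (fun z : ℝ × ℝ => |z.1 - z.2| ^ (2 * H - 2)) z := fun z => by
    unfold stepKernel
    rw [Finset.sum_mul]
    refine Finset.sum_congr rfl fun i _ => ?_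
    rw [Finset.sum_mul]
    refine Finset.sum_congr rfl fun j _ => ?_
    by_cases hz : z ∈ Set.Ico (uniformPoint t N i) (uniformPoint t N (i + 1)) ×ˢ
      Set.Ico (uniformPoint s N j) (uniformPoint s N (j + 1))
    · rw [Set.indicator_of_mem hz, Set.indicator_of_mem hz]
    · rw [Set.indicator_of_notMem hz, Set.indicator_of_notMem hz, zero_mul, mul_zero]
  have hi : ∀ i j, Integrable fun z : ℝ × ℝ =>
      (t - uniformPoint t N i + (s - uniformPoint s N j)) ^ (-γ) *
        (Set.Ico (uniformPoint t N i) (uniformPoint t N (i + 1)) ×ˢ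
          Set.Ico (uniformPoint s N j) (uniformPoint s N (j + 1))).indicator
            (fun z : ℝ × ℝ => |z.1 - z.2| ^ (2 * H - 2)) z := fun i j =>
    ((integrable_indicator_iff (hmeas i j)).2 (hcell i j)).const_mul _
  simp_rw [hR]
  rw [integral_finsetSum _ fun i _ => integrable_finsetSum _ fun j _ => hi i j]
  simp_rw [fun i => integral_finsetSum (Finset.range N) fun j _ => hi i j, convolutionSum,
    Finset.sum_mul_sum]
  have mS : ∀ {r : ℝ} (_ : 0 < r) (i : ℕ), i ∈ Finset.range N → MemLp (fun ω =>
      Z (r - uniformPoint r N i) ω * (B (uniformPoint r N (i + 1)) ω - B (uniformPoint r N i) ω)) 2 P :=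
    fun {r} hr i hi => memLp_two_mul_increment hB hZ hZB
      (sub_pos.2 (uniformPoint_lt hr (Finset.mem_range.1 hi)))
      (uniformPoint_nonneg hr.le N i) (uniformPoint_nonneg hr.le N (i + 1))
  have mI : ∀ i ∈ Finset.range N, ∀ j ∈ Finset.range N, Integrable (fun ω =>
      Z (t - uniformPoint t N i) ω * (B (uniformPoint t N (i + 1)) ω - B (uniformPoint t N i) ω) *
      (Z (s - uniformPoint s N j) ω *
        (B (uniformPoint s N (j + 1)) ω - B (uniformPoint s N j) ω))) P :=
    fun i hi j hj => (mS ht i hi).integrable_mul (mS hs j hj)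
  rw [integral_finsetSum _ fun i hi => integrable_finsetSum _ fun j hj => mI i hi j hj,
    Finset.mul_sum]
  refine Finset.sum_congr rfl fun i hi => ?_
  rw [integral_finsetSum _ fun j hj => mI i hi j hj, Finset.mul_sum]
  refine Finset.sum_congr rfl fun j hj => ?_
  have hti : 0 < t - uniformPoint t N i := sub_pos.2 (uniformPoint_lt ht (Finset.mem_range.1 hi))
  have hsj : 0 < s - uniformPoint s N j := sub_pos.2 (uniformPoint_lt hs (Finset.mem_range.1 hj))
  have hi0 := uniformPoint_nonneg ht.le N i
  have hi1 := uniformPoint_nonneg ht.le N (i + 1)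
  have hj0 := uniformPoint_nonneg hs.le N j
  have hj1 := uniformPoint_nonneg hs.le N (j + 1)
  rw [integral_const_mul, integral_indicator (hmeas i j), mul_left_comm,
    ← hB.integral_increment_mul hH hH' hi0 (uniformPoint_le_succ ht.le N i) hj0
      (uniformPoint_le_succ hs.le N j),
    ← hZ.covariance (t - uniformPoint t N i) hti (s - uniformPoint s N j) hsj]
  have mB : ∀ {r : ℝ} (_ : 0 ≤ r), MemLp (B r) 2 P := fun hr =>
    IsCenteredGaussianOn.memLp_two hB hr
  rw [← (IndepFun.of_process hZB hti hsj hi0 hi1 hj0 hj1).integral_fun_mul_eq_mul_integral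
    ((hZ.memLp_two hti).1.mul (hZ.memLp_two hsj).1)
    (((mB hi1).sub (mB hi0)).1.mul ((mB hj1).sub (mB hj0)).1)]
  exact integral_congr_ae (ae_of_all _ fun ω => by ring)

theorem tendsto_integral_mul_of_tendsto_eLpNorm {f g : ℕ → Ω → ℝ} {f₀ g₀ : Ω → ℝ}
    (hf : ∀ n, MemLp (f n) 2 P) (hg : ∀ n, MemLp (g n) 2 P) (hf₀ : MemLp f₀ 2 P)
    (hg₀ : MemLp g₀ 2 P) (hfl : Tendsto (fun n => eLpNorm (f n - f₀) 2 P) atTop (𝓝 0))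
    (hgl : Tendsto (fun n => eLpNorm (g n - g₀) 2 P) atTop (𝓝 0)) :
    Tendsto (fun n => ∫ ω, f n ω * g n ω ∂P) atTop (𝓝 (∫ ω, f₀ ω * g₀ ω ∂P)) := by
  have h1 := (Lp.tendsto_Lp_iff_tendsto_eLpNorm'' f hf f₀ hf₀).2 hfl
  have h2 := (Lp.tendsto_Lp_iff_tendsto_eLpNorm'' g hg g₀ hg₀).2 hgl
  have e : ∀ {u v : Ω → ℝ} (hu : MemLp u 2 P) (hv : MemLp v 2 P),
      inner ℝ (hv.toLp v) (hu.toLp u) = ∫ ω, u ω * v ω ∂P := by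
    intro u v hu hv
    rw [L2.inner_def]
    refine integral_congr_ae ?_
    filter_upwards [hu.coeFn_toLp, hv.coeFn_toLp] with ω a b
    rw [a, b]
    simp
  have := h2.inner (𝕜 := ℝ) h1
  simpa only [e] using this

theorem IsConvolutionIntegral.tendsto_uniform {t : ℝ} {J : Ω → ℝ} (ht : 0 < t)
    (hJ : IsConvolutionIntegral P Z B t J) :
    Tendsto (fun n : ℕ => eLpNorm (convolutionSum Z B t (n + 1) (uniformPoint t (n + 1)) - J) 2 P)
      atTop (𝓝 0) := by
  rw [ENNReal.tendsto_nhds_zero]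
  intro ε hε
  obtain ⟨η, hη0, hη⟩ : ∃ η : ℝ, 0 < η ∧ ENNReal.ofReal η ≤ ε := by
    rcases eq_or_ne ε ∞ with rfl | h
    · exact ⟨1, one_pos, le_top⟩
    · exact ⟨ε.toReal, ENNReal.toReal_pos hε.ne' h, ENNReal.ofReal_toReal_le⟩
  obtain ⟨δ, hδ, h⟩ := hJ.2 η hη0
  have hlim : Tendsto (fun n : ℕ => t / ((n + 1 : ℕ) : ℝ)) atTop (𝓝 0) :=
    (tendsto_const_div_atTop_nhds_zero_nat t).comp (tendsto_add_atTop_nat 1)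
  filter_upwards [hlim.eventually_lt_const hδ] with n hn
  refine le_trans (h (n + 1) (uniformPoint t (n + 1)) (by simp [uniformPoint]) ?_ fun i _ => ?_) hη
  · unfold uniformPoint
    field_simp
  · have e := uniformPoint_succ_sub (t := t) (N := n + 1) i
    have : 0 < t / ((n + 1 : ℕ) : ℝ) := by positivity
    exact ⟨by linarith, by linarith⟩

/-- The covariance of the stochastic convolution integrals. -/
theorem integral_convolutionIntegral_mul (hH : 1 / 2 < H) (hH' : H < 1) (hγ : 0 < γ)
    (hγ' : γ < 2 * H) (hB : IsFractionalBrownianMotion H B P)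
    (hZ : IsCenteredGaussianOn (Set.Ioi 0) (fun t s => (t + s) ^ (-γ)) Z P)
    (hZB : IndepFun (fun ω (t : Set.Ioi (0 : ℝ)) => Z t ω) (fun ω (t : Set.Ici (0 : ℝ)) => B t ω) P)
    {t s : ℝ} (ht : 0 < t) (hs : 0 < s) {J K : Ω → ℝ} (hJ : IsConvolutionIntegral P Z B t J)
    (hK : IsConvolutionIntegral P Z B s K) :
    ∫ ω, J ω * K ω ∂P = H * (2 * H - 1) * convCov γ (2 * H - 2) t s := by
  have h1 := tendsto_integral_mul_of_tendsto_eLpNorm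
    (fun n => memLp_two_convolutionSum hB hZ hZB ht (n + 1))
    (fun n => memLp_two_convolutionSum hB hZ hZB hs (n + 1)) hJ.1 hK.1
    (hJ.tendsto_uniform ht) (hK.tendsto_uniform hs)
  simp_rw [fun n : ℕ => integral_convolutionSum_mul hH hH' hB hZ hZB ht hs (n + 1)] at h1
  exact tendsto_nhds_unique h1
    ((tendsto_integral_stepKernel hγ (by linarith) (by linarith) (by linarith) ht hs).const_mul _)

end Covariance

/-! ### Pointwise and mean bounds on second differences of the covariance. -/

section CovarianceBounds

/-- The second difference `E[(X_{s+h} - X_s)(X_{t+h} - X_t)]` of a covariance function. -/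
def covSecondDiff (C : ℝ → ℝ → ℝ) (h s t : ℝ) : ℝ :=
  C (s + h) (t + h) - C (s + h) t - C s (t + h) + C s t

variable {γ p : ℝ}

theorem abs_le_of_enorm_le_ofReal {a b : ℝ} (hb : 0 ≤ b) (h : ‖a‖ₑ ≤ ENNReal.ofReal b) : |a| ≤ b := by
  rwa [← ofReal_norm, ENNReal.ofReal_le_ofReal_iff hb] at h

theorem abs_convCov_secondDiff_le (hγ : 0 < γ) (hp : -1 < p) (hp' : p < 0) (hγp : γ < p + 2) :
    ∃ K : ℝ, 0 < K ∧ ∀ h s t : ℝ, 0 < h → 0 ≤ s → 0 ≤ t →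
      |covSecondDiff (convCov γ p) h s t| ≤ K * h ^ (p + 2 - γ) := by
  obtain ⟨K, hK⟩ := incrEnergy_le hγ hp hp' hγp
  have hΓ : 0 < (Real.Gamma γ)⁻¹ := inv_pos.2 (Real.Gamma_pos_of_pos hγ)
  refine ⟨(Real.Gamma γ)⁻¹ * (|K| + 1), by positivity, fun h s t hh hs ht => ?_⟩
  refine abs_le_of_enorm_le_ofReal (by positivity) ?_
  refine (enorm_convCov_secondDiff_le hγ hp hp' hγp hh.le hh.le hs ht).trans ?_
  rw [mul_assoc, ENNReal.ofReal_mul hΓ.le]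
  refine mul_le_mul_right ((hK h h h s t hh.le le_rfl hh.le le_rfl hh).trans ?_) _
  refine ENNReal.ofReal_le_ofReal ?_
  gcongr
  linarith [le_abs_self K]

theorem abs_convCov_le (hγ : 0 < γ) (hp : -1 < p) (hp' : p < 0) (hγp : γ < p + 2) :
    ∃ K : ℝ, 0 < K ∧ ∀ t s : ℝ, 0 ≤ t → t ≤ 1 → 0 ≤ s → s ≤ 1 → |convCov γ p t s| ≤ K := by
  obtain ⟨K, hK⟩ := incrEnergy_le hγ hp hp' hγp
  have hΓ : 0 < (Real.Gamma γ)⁻¹ := inv_pos.2 (Real.Gamma_pos_of_pos hγ)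
  refine ⟨(Real.Gamma γ)⁻¹ * (|K| + 1), by positivity, fun t s ht ht1 hs hs1 => ?_⟩
  refine abs_le_of_enorm_le_ofReal (by positivity) ?_
  have h := enorm_convCov_secondDiff_le hγ hp hp' hγp ht hs le_rfl le_rfl
  simp only [zero_add, convCov_zero_left, convCov_zero_right, sub_zero, add_zero] at h
  refine h.trans ?_
  rw [ENNReal.ofReal_mul hΓ.le]
  refine mul_le_mul_right ((hK t s 1 0 0 ht ht1 hs hs1 one_pos).trans ?_) _
  refine ENNReal.ofReal_le_ofReal ?_
  rw [Real.one_rpow, mul_one]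
  linarith [le_abs_self K]

theorem lintegral_abs_convCov_secondDiff_le (hγ : 0 < γ) (hp : -1 < p) (hp' : p < 0)
    (hγp : γ < p + 2) :
    ∃ K : ℝ, ∀ h s : ℝ, 0 < h → 0 ≤ s →
      ∫⁻ t in Set.Ioo (0 : ℝ) 1, ENNReal.ofReal |covSecondDiff (convCov γ p) h s t| ≤
        ENNReal.ofReal (K * h ^ (2 - γ)) := by
  obtain ⟨K, hK⟩ := lintegral_incrEnergy_le hγ hp hp' (by linarith)
  have hΓ : 0 < (Real.Gamma γ)⁻¹ := inv_pos.2 (Real.Gamma_pos_of_pos hγ)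
  refine ⟨(Real.Gamma γ)⁻¹ * K, fun h s hh hs => ?_⟩
  calc _ ≤ ∫⁻ t in Set.Ioo (0 : ℝ) 1, ENNReal.ofReal (Real.Gamma γ)⁻¹ * incrEnergy γ p h h s t := by
        refine setLIntegral_mono' measurableSet_Ioo fun t ht => ?_
        rw [← Real.norm_eq_abs, ofReal_norm]
        exact enorm_convCov_secondDiff_le hγ hp hp' hγp hh.le hh.le hs ht.1.le
    _ ≤ _ := by
        rw [lintegral_const_mul' _ _ ENNReal.ofReal_ne_top, mul_assoc, ENNReal.ofReal_mul hΓ.le]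
        exact mul_le_mul_right (hK h s hh) _

end CovarianceBounds

/-! ### Path regularity of Gaussian processes from their covariance. -/

section GaussianPaths

variable {Ω : Type*} [MeasurableSpace Ω] {P : Measure Ω}

theorem HasGaussianMGF.congr {X Y X' Y' : Ω → ℝ} {a b c : ℝ} (h : HasGaussianMGF P X Y a b c)
    (hX : X =ᵐ[P] X') (hY : Y =ᵐ[P] Y') : HasGaussianMGF P X' Y' a b c := by
  intro x y
  rw [← h x y]
  refine lintegral_congr_ae ?_
  filter_upwards [hX, hY] with ω h1 h2
  rw [h1, h2]

/-- A centered Gaussian law is determined by its variance, and the variance of `xU + yV` is the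
required quadratic form. -/
theorem hasGaussianMGF_of_forall_hasGaussianLaw [IsProbabilityMeasure P] {U V : Ω → ℝ}
    (hU : MemLp U 2 P) (hV : MemLp V 2 P)
    (hU0 : ∫ ω, U ω ∂P = 0) (hV0 : ∫ ω, V ω ∂P = 0)
    (h : ∀ x y : ℝ, HasGaussianLaw (fun ω => x * U ω + y * V ω) P) :
    HasGaussianMGF P U V (∫ ω, U ω * U ω ∂P) (∫ ω, V ω * V ω ∂P) (∫ ω, U ω * V ω ∂P) := by
  intro x y
  have hUi := hU.integrable (by norm_num)
  have hVi := hV.integrable (by norm_num)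
  have hmean : ∫ ω, x * U ω + y * V ω ∂P = 0 := by
    rw [integral_add (hUi.const_mul x) (hVi.const_mul y), integral_const_mul, integral_const_mul, hU0,
      hV0]
    simp
  have hvar : Var[fun ω => x * U ω + y * V ω; P] = (∫ ω, U ω * U ω ∂P) * x ^ 2 +
      2 * (∫ ω, U ω * V ω ∂P) * x * y + (∫ ω, V ω * V ω ∂P) * y ^ 2 := by
    rw [variance_of_integral_eq_zero (h x y).aemeasurable hmean]
    have i1 : Integrable (fun ω => U ω * U ω) P := hU.integrable_mul hU
    have i2 : Integrable (fun ω => U ω * V ω) P := hU.integrable_mul hV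
    have i3 : Integrable (fun ω => V ω * V ω) P := hV.integrable_mul hV
    have e : ∀ ω, ((fun ω => x * U ω + y * V ω) ω) ^ 2 = (x ^ 2 * (U ω * U ω) +
        (2 * x * y) * (U ω * V ω)) + y ^ 2 * (V ω * V ω) := fun ω => by ring
    simp only [e]
    rw [integral_add (f := fun ω => x ^ 2 * (U ω * U ω) + (2 * x * y) * (U ω * V ω))
        ((i1.const_mul _).add (i2.const_mul _)) (i3.const_mul _),
      integral_add (i1.const_mul _) (i2.const_mul _), integral_const_mul, integral_const_mul,
      integral_const_mul]
    ring
  have hmap := (h x y).map_eq_gaussianReal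
  rw [hmean] at hmap
  have key := lintegral_exp_mul_gaussianReal (Var[fun ω => x * U ω + y * V ω; P]).toNNReal 1
  rw [← hmap, lintegral_map' (by fun_prop) (h x y).aemeasurable,
    Real.coe_toNNReal _ (variance_nonneg _ _), hvar] at key
  simpa using key

variable [IsProbabilityMeasure P] {T : Set ℝ} {C : ℝ → ℝ → ℝ} {X : ℝ → Ω → ℝ}

theorem IsCenteredGaussianOn.hasGaussianMGF_mul (h : IsCenteredGaussianOn T C X P) (k : ℝ) {t : ℝ}
    (ht : t ∈ T) :
    HasGaussianMGF P (fun ω => k * X t ω) (fun ω => k * X t ω) (k ^ 2 * C t t) (k ^ 2 * C t t)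
      (k ^ 2 * C t t) := by
  have hm : MemLp (fun ω => k * X t ω) 2 P := (h.memLp_two ht).const_mul k
  have h0 : ∫ ω, k * X t ω ∂P = 0 := by rw [integral_const_mul, h.centered t ht, mul_zero]
  have hc : ∫ ω, k * X t ω * (k * X t ω) ∂P = k ^ 2 * C t t := by
    rw [← h.covariance t ht t ht, ← integral_const_mul]
    exact integral_congr_ae (ae_of_all _ fun ω => by ring)
  have := hasGaussianMGF_of_forall_hasGaussianLaw hm hm h0 h0 fun x y => by
    refine ((h.gaussian.hasGaussianLaw_eval ⟨t, ht⟩).fun_smul (x * k + y * k)).congr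
      (ae_of_all _ fun ω => ?_)
    simp only [smul_eq_mul]
    ring
  rwa [hc] at this

theorem IsCenteredGaussianOn.hasGaussianMGF_increments (h : IsCenteredGaussianOn T C X P) (k : ℝ)
    {a b c d : ℝ} (ha : a ∈ T) (hb : b ∈ T) (hc : c ∈ T) (hd : d ∈ T) :
    HasGaussianMGF P (fun ω => k * (X b ω - X a ω)) (fun ω => k * (X d ω - X c ω))
      (k ^ 2 * (C b b - C b a - C a b + C a a)) (k ^ 2 * (C d d - C d c - C c d + C c c))
      (k ^ 2 * (C b d - C b c - C a d + C a c)) := by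
  have hm : ∀ {u v : ℝ}, u ∈ T → v ∈ T → MemLp (fun ω => k * (X v ω - X u ω)) 2 P := fun hu hv =>
    ((h.memLp_two hv).sub (h.memLp_two hu)).const_mul k
  have h0 : ∀ {u v : ℝ}, u ∈ T → v ∈ T → ∫ ω, k * (X v ω - X u ω) ∂P = 0 := fun {u v} hu hv => by
    rw [integral_const_mul, integral_sub ((h.memLp_two hv).integrable (by norm_num))
      ((h.memLp_two hu).integrable (by norm_num)), h.centered v hv, h.centered u hu]
    simp
  have hcov : ∀ {u v u' v' : ℝ}, u ∈ T → v ∈ T → u' ∈ T → v' ∈ T →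
      ∫ ω, k * (X v ω - X u ω) * (k * (X v' ω - X u' ω)) ∂P =
        k ^ 2 * (C v v' - C v u' - C u v' + C u u') := fun hu hv hu' hv' => by
    rw [← h.integral_increment_mul hu hv hu' hv', ← integral_const_mul]
    exact integral_congr_ae (ae_of_all _ fun ω => by ring)
  have := hasGaussianMGF_of_forall_hasGaussianLaw (hm ha hb) (hm hc hd) (h0 ha hb) (h0 hc hd)
    fun x y => by
      -- A combination of two increments is a combination of four values, possibly with repeated
      -- times.
      have g := ((h.gaussian.comp_right (![⟨a, ha⟩, ⟨b, hb⟩, ⟨c, hc⟩, ⟨d, hd⟩] : Fin 4 → T)).smul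
        (![-(x * k), x * k, -(y * k), y * k] : Fin 4 → ℝ)).hasGaussianLaw_fun_sum
          (I := Finset.univ)
      refine g.congr (ae_of_all _ fun ω => ?_)
      simp [Fin.sum_univ_four]
      ring
  rwa [hcov ha hb ha hb, hcov hc hd hc hd, hcov ha hb hc hd] at this

theorem volume_shiftDomain_le_one (h : ℝ) : volume (shiftDomain h) ≤ 1 :=
  (measure_mono (fun _ hs => hs.1)).trans (by simp : volume (Set.Ioo (0 : ℝ) 1) ≤ 1)

/-- A measurable centered Gaussian process whose covariance has second differences of order
`h ^ (2α)`, and of strictly smaller order in the mean, has paths in `B^α_{Φ₂,∞}(0,1)`. -/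
theorem ae_memBesovOrlicz_of_covSecondDiff_le {α δ : ℝ} (hα : 0 < α) (hδ : 0 < δ)
    (hX : IsCenteredGaussianOn T C X P) (hT : Set.Ioo (0 : ℝ) 1 ⊆ T)
    (hmeas : AEMeasurable (fun x : ℝ × Ω => X x.1 x.2)
      ((volume.restrict (Set.Ioo (0 : ℝ) 1)).prod P))
    {K₀ K₁ K₂ : ℝ} (hK₀ : 0 < K₀) (hK₁ : 0 < K₁)
    (h₀ : ∀ t ∈ Set.Ioo (0 : ℝ) 1, C t t ≤ K₀)
    (h₁ : ∀ h, 0 < h → ∀ s ∈ shiftDomain h, ∀ t ∈ shiftDomain h,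
      |covSecondDiff C h s t| ≤ K₁ * h ^ (2 * α))
    (h₂ : ∀ h, 0 < h → ∀ s ∈ shiftDomain h,
      ∫⁻ t in shiftDomain h, ENNReal.ofReal |covSecondDiff C h s t| ≤
        ENNReal.ofReal (K₂ * h ^ (2 * α + δ))) :
    ∀ᵐ ω ∂P, MemBesovOrlicz α 2 (fun t => X t ω) := by
  -- `g` is a jointly measurable version: almost every path agrees with that of `X` almost
  -- everywhere, and for almost every `t` the variables agree almost surely, so Gaussian laws
  -- transfer.
  set g : ℝ → Ω → ℝ := fun t ω => hmeas.mk _ (t, ω)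
  have hg : Measurable (Function.uncurry g) := hmeas.measurable_mk
  have hgX : ∀ᵐ t ∂volume.restrict (Set.Ioo (0 : ℝ) 1), X t =ᵐ[P] g t :=
    Measure.ae_ae_of_ae_prod hmeas.ae_eq_mk
  have hgX' : ∀ᵐ ω ∂P, ∀ᵐ t ∂volume.restrict (Set.Ioo (0 : ℝ) 1), g t ω = X t ω := by
    have := Measure.ae_ae_of_ae_prod ((Measure.measurePreserving_swap (μ := P)
      (ν := volume.restrict (Set.Ioo (0 : ℝ) 1))).quasiMeasurePreserving.ae hmeas.ae_eq_mk)
    filter_upwards [this] with ω h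
    filter_upwards [h] with t ht using ht.symm
  -- the Orlicz norm of the path
  set k₀ : ℝ := √(1 / (8 * K₀))
  have hk₀ : 0 < k₀ := Real.sqrt_pos.2 (by positivity)
  have hk₀sq : k₀ ^ 2 = 1 / (8 * K₀) := Real.sq_sqrt (by positivity)
  have hpath : ∀ᵐ ω ∂P, expOrliczNorm 2 (Set.Ioo (0 : ℝ) 1) (fun t => g t ω) < ∞ := by
    have hm : Measurable (Function.uncurry fun s ω => k₀ * g s ω) := hg.const_mul k₀
    have hle := lintegral_lintegral_exp_sq_le (P := P) (S := Set.Ioo (0 : ℝ) 1) (by simp)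
      (X := fun s ω => k₀ * g s ω) hm (c := fun s => k₀ ^ 2 * C s s)
      (by
        filter_upwards [ae_restrict_mem measurableSet_Ioo] with s hs
        rw [hk₀sq, div_mul_eq_mul_div, one_mul, div_le_div_iff₀ (by positivity) (by norm_num)]
        linarith [h₀ s hs])
      (by
        filter_upwards [ae_restrict_mem measurableSet_Ioo, hgX] with s hs hsX
        have e : (fun ω => k₀ * X s ω) =ᵐ[P] fun ω => k₀ * g s ω := by
          filter_upwards [hsX] with ω hω
          rw [hω]
        exact (hX.hasGaussianMGF_mul k₀ (hT hs)).congr e e)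
    have hfin := ae_lt_top (Measurable.lintegral_prod_right'
      (f := fun z : Ω × ℝ => ENNReal.ofReal (Real.exp ((k₀ * g z.2 z.1) ^ 2))) (by fun_prop))
      (hle.trans_lt (lintegral_exp_sq_gaussianReal_lt_top (by norm_num))).ne
    filter_upwards [hfin] with ω hω
    have := expOrliczNorm_two_le_of_lintegral_exp_sq (le_max_left 1 _) (le_max_right 1
      (∫⁻ s in Set.Ioo (0 : ℝ) 1, ENNReal.ofReal (Real.exp ((k₀ * g s ω) ^ 2))))
    rw [expOrliczNorm_const_mul, abs_of_pos hk₀] at this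
    by_contra htop
    rw [not_lt, top_le_iff] at htop
    rw [htop, ENNReal.mul_top (by simpa using hk₀)] at this
    exact absurd this (not_le.2 (max_lt ENNReal.one_lt_top hω))
  -- the dyadic increments
  set k : ℝ := √(1 / (8 * K₁))
  have hk : 0 < k := Real.sqrt_pos.2 (by positivity)
  have hksq : k ^ 2 = 1 / (8 * K₁) := Real.sq_sqrt (by positivity)
  set h : ℕ → ℝ := fun n => (1 / 2) ^ (n + 1) with hh
  have hpos : ∀ n, 0 < h n := fun n => by positivity
  -- The normalization satisfies `κ n ^ 2 * K₁ * h n ^ (2α) = 1/8`, the threshold of the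
  -- decorrelation inequality.
  set κ : ℕ → ℝ := fun n => k * h n ^ (-α)
  have hκ : ∀ n, 0 < κ n := fun n => mul_pos hk (Real.rpow_pos_of_pos (hpos n) _)
  have hκsq : ∀ n, κ n ^ 2 = 1 / (8 * K₁) * h n ^ (-(2 * α)) := fun n => by
    simp only [κ]
    rw [mul_pow, hksq, ← Real.rpow_natCast (h n ^ (-α)), ← Real.rpow_mul (hpos n).le]
    congr 2
    push_cast
    ring
  have hincr : ∀ᵐ ω ∂P, ∃ M < ∞, ∀ n, ∫⁻ s in shiftDomain (h n),
      ENNReal.ofReal (Real.exp ((κ n * (g (s + h n) ω - g s ω)) ^ 2)) ≤ M := by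
    have hmgf : ∀ n, ∀ᵐ s ∂volume.restrict (shiftDomain (h n)),
        ∀ᵐ t ∂volume.restrict (shiftDomain (h n)),
          HasGaussianMGF P (fun ω => κ n * (g (s + h n) ω - g s ω))
            (fun ω => κ n * (g (t + h n) ω - g t ω)) (κ n ^ 2 * covSecondDiff C (h n) s s)
            (κ n ^ 2 * covSecondDiff C (h n) t t) (κ n ^ 2 * covSecondDiff C (h n) s t) ∧
          HasGaussianMGF P (fun ω => κ n * (g (s + h n) ω - g s ω))
            (fun ω => κ n * (g (s + h n) ω - g s ω)) (κ n ^ 2 * covSecondDiff C (h n) s s)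
            (κ n ^ 2 * covSecondDiff C (h n) s s) (κ n ^ 2 * covSecondDiff C (h n) s s) := by
      intro n
      have hincX := ae_restrict_shiftDomain hgX (h n)
      have e : ∀ {s}, X s =ᵐ[P] g s ∧ X (s + h n) =ᵐ[P] g (s + h n) →
          (fun ω => κ n * (X (s + h n) ω - X s ω)) =ᵐ[P]
            fun ω => κ n * (g (s + h n) ω - g s ω) := fun hs => by
        filter_upwards [hs.1, hs.2] with ω e1 e2
        rw [e1, e2]
      filter_upwards [ae_restrict_mem (measurableSet_shiftDomain (h n)), hincX] with s hs hsX
      filter_upwards [ae_restrict_mem (measurableSet_shiftDomain (h n)), hincX] with t ht htX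
      exact ⟨(hX.hasGaussianMGF_increments (κ n) (hT hs.1) (hT hs.2) (hT ht.1) (hT ht.2)).congr
          (e hsX) (e htX),
        (hX.hasGaussianMGF_increments (κ n) (hT hs.1) (hT hs.2) (hT hs.1) (hT hs.2)).congr
          (e hsX) (e hsX)⟩
    refine ae_exists_forall_lintegral_exp_sq_le (S := fun n => shiftDomain (h n))
      (fun n => volume_shiftDomain_le_one (h n))
      (X := fun n s ω => κ n * (g (s + h n) ω - g s ω)) (fun n => ?_)
      (c := fun n s t => κ n ^ 2 * covSecondDiff C (h n) s t) (fun n s hs t ht => ?_)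
      (fun n => measurableSet_shiftDomain (h n)) (fun n => ?_) (fun n => ?_) ?_
    · have m : Measurable fun z : ℝ × Ω => κ n * (g (z.1 + h n) z.2 - g z.1 z.2) := by fun_prop
      exact m
    · rw [abs_mul, abs_of_nonneg (sq_nonneg _), hκsq]
      calc _ ≤ 1 / (8 * K₁) * h n ^ (-(2 * α)) * (K₁ * h n ^ (2 * α)) := by
            have := Real.rpow_pos_of_pos (hpos n) (-(2 * α))
            gcongr
            exact h₁ (h n) (hpos n) s hs t ht
        _ = 1 / 8 := by
            have := Real.rpow_pos_of_pos (hpos n) (2 * α)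
            rw [Real.rpow_neg (hpos n).le]
            field_simp
    · filter_upwards [hmgf n] with s hs
      filter_upwards [hs] with t ht using ht.1
    -- The diagonal law does not depend on `t`, so one admissible `t` suffices.
    · rcases eq_or_ne (volume.restrict (shiftDomain (h n))) 0 with h0 | h0
      · rw [h0]; simp
      · have : (ae (volume.restrict (shiftDomain (h n)))).NeBot := ae_neBot.2 h0
        filter_upwards [hmgf n] with s hs
        obtain ⟨t, ht⟩ := hs.exists
        exact ht.2
    -- After normalization the factor `h n ^ (2α)` cancels; the surplus `h n ^ δ` makes the series
    -- converge.
    · have hb : ∀ n, ∫⁻ s in shiftDomain (h n), ∫⁻ t in shiftDomain (h n),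
          ENNReal.ofReal |κ n ^ 2 * covSecondDiff C (h n) s t| ≤
            ENNReal.ofReal (|K₂| / (8 * K₁)) * ENNReal.ofReal (h n ^ δ) := by
        intro n
        have hin : ∀ s ∈ shiftDomain (h n), ∫⁻ t in shiftDomain (h n),
            ENNReal.ofReal |κ n ^ 2 * covSecondDiff C (h n) s t| ≤
              ENNReal.ofReal (|K₂| / (8 * K₁)) * ENNReal.ofReal (h n ^ δ) := by
          intro s hs
          have e : ∀ t, ENNReal.ofReal |κ n ^ 2 * covSecondDiff C (h n) s t| =
              ENNReal.ofReal (κ n ^ 2) * ENNReal.ofReal |covSecondDiff C (h n) s t| := fun t => by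
            rw [abs_mul, abs_of_nonneg (sq_nonneg _), ENNReal.ofReal_mul (sq_nonneg _)]
          simp_rw [e]
          rw [lintegral_const_mul' _ _ ENNReal.ofReal_ne_top]
          refine (mul_le_mul_right (h₂ (h n) (hpos n) s hs) _).trans ?_
          rw [← ENNReal.ofReal_mul (sq_nonneg _), ← ENNReal.ofReal_mul (by positivity), hκsq]
          refine ENNReal.ofReal_le_ofReal ?_
          have p1 := Real.rpow_pos_of_pos (hpos n) (2 * α)
          have p2 := Real.rpow_pos_of_pos (hpos n) δ
          rw [Real.rpow_neg (hpos n).le, Real.rpow_add (hpos n)]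
          calc _ = K₂ / (8 * K₁) * h n ^ δ := by field_simp
            _ ≤ _ := by gcongr; exact le_abs_self _
        calc _ ≤ ∫⁻ s in shiftDomain (h n),
              ENNReal.ofReal (|K₂| / (8 * K₁)) * ENNReal.ofReal (h n ^ δ) :=
              setLIntegral_mono' (measurableSet_shiftDomain (h n)) hin
          _ ≤ _ := by
              rw [lintegral_const, Measure.restrict_apply_univ]
              exact mul_le_of_le_one_right' (volume_shiftDomain_le_one (h n))
      refine (ENNReal.tsum_le_tsum hb).trans_lt ?_
      rw [ENNReal.tsum_mul_left]
      refine ENNReal.mul_lt_top ENNReal.ofReal_lt_top ?_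
      have := tsum_dyadic_rpow_le hδ one_pos
      have h1 : ∀ n : ℕ, (1 / 2 : ℝ) ^ (n + 1) ≤ 1 := fun n =>
        pow_le_one₀ (by norm_num) (by norm_num)
      simp only [h1, if_true] at this
      exact this.trans_lt ENNReal.ofReal_lt_top
  filter_upwards [hgX', hpath, hincr] with ω e hω₀ hω₁
  refine MemBesovOrlicz.congr_ae ?_ e
  obtain ⟨M, hM, hMn⟩ := hω₁
  refine memBesovOrlicz_of_dyadic hα (by fun_prop) hω₀
    (M := max 1 M * ENNReal.ofReal k⁻¹)
    (ENNReal.mul_lt_top (max_lt ENNReal.one_lt_top hM) ENNReal.ofReal_lt_top) fun n => ?_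
  have hn := expOrliczNorm_two_le_of_lintegral_exp_sq (le_max_left 1 M)
    ((hMn n).trans (le_max_right 1 M))
  -- Undoing the normalization restores the factor `(κ n)⁻¹ = k⁻¹ * h n ^ α`.
  have heq : ∀ s, g (s + h n) ω - g s ω = (κ n)⁻¹ * (κ n * (g (s + h n) ω - g s ω)) := fun s => by
    rw [inv_mul_cancel_left₀ (hκ n).ne']
  change expOrliczNorm 2 (shiftDomain (h n)) (fun s => g (s + h n) ω - g s ω) ≤ _
  rw [funext heq, expOrliczNorm_const_mul, abs_of_pos (inv_pos.2 (hκ n))]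
  refine (mul_le_mul_right hn _).trans_eq ?_
  rw [mul_comm, mul_assoc, ← ENNReal.ofReal_mul (inv_nonneg.2 hk.le)]
  congr 2
  simp only [κ]
  rw [mul_inv, Real.rpow_neg (hpos n).le, inv_inv]

end GaussianPaths

/-! ### Conclusion. -/

theorem mainTheorem4
    (H γ : ℝ) (hH : 1 / 2 < H) (hH' : H < 1) (hγ : 0 < γ) (hγ' : γ < 2 * H)
    -- the processes `B`, `Z` and the integrals `J t = ∫_0^t Z_{t-r} dB_r` defining the covariance
    {Ω' : Type*} [MeasurableSpace Ω'] (P' : Measure Ω') [IsProbabilityMeasure P']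
    (B Z J : ℝ → Ω' → ℝ)
    (hB : IsFractionalBrownianMotion H B P')
    (hZ : IsCenteredGaussianOn (Set.Ioi 0) (fun t s => (t + s) ^ (-γ)) Z P')
    (hZB : IndepFun (fun ω (t : Set.Ioi (0 : ℝ)) => Z t ω) (fun ω (t : Set.Ici (0 : ℝ)) => B t ω) P')
    (hJ : ∀ t, 0 ≤ t → IsConvolutionIntegral P' Z B t (J t))
    -- the process `G`
    {Ω : Type*} [MeasurableSpace Ω] (P : Measure Ω) [IsProbabilityMeasure P]
    (G : ℝ → Ω → ℝ)
    (hG : IsCenteredGaussianOn (Set.Ici 0) (fun t s => ∫ ω, J t ω * J s ω ∂P') G P)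
    (hGmeas : AEMeasurable (fun x : ℝ × Ω => G x.1 x.2)
      ((volume.restrict (Set.Ioo (0 : ℝ) 1)).prod P)) :
    ∀ᵐ ω ∂P, MemBesovOrlicz (H - γ / 2) 2 (fun t => G t ω) := by
  have hp : -1 < 2 * H - 2 := by linarith
  have hp' : 2 * H - 2 < 0 := by linarith
  have hγp : γ < 2 * H - 2 + 2 := by linarith
  obtain ⟨K₀, hK₀, b₀⟩ := abs_convCov_le hγ hp hp' hγp
  obtain ⟨K₁, hK₁, b₁⟩ := abs_convCov_secondDiff_le hγ hp hp' hγp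
  obtain ⟨K₂, b₂⟩ := lintegral_abs_convCov_secondDiff_le hγ hp hp' hγp
  obtain ⟨c, hcH⟩ : ∃ c, c = H * (2 * H - 1) := ⟨_, rfl⟩
  have hc : 0 < c := hcH ▸ mul_pos (by linarith) (by linarith)
  have hcov : ∀ {t s : ℝ}, 0 < t → 0 < s →
      ∫ ω, J t ω * J s ω ∂P' = c * convCov γ (2 * H - 2) t s := fun {t s} ht hs =>
    hcH ▸ integral_convolutionIntegral_mul hH hH' hγ hγ' hB hZ hZB ht hs (hJ t ht.le) (hJ s hs.le)
  have hsd : ∀ {h s t : ℝ}, s ∈ shiftDomain h → t ∈ shiftDomain h →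
      covSecondDiff (fun t s => ∫ ω, J t ω * J s ω ∂P') h s t =
        c * covSecondDiff (convCov γ (2 * H - 2)) h s t := fun hs ht => by
    unfold covSecondDiff
    beta_reduce
    rw [hcov hs.2.1 ht.2.1, hcov hs.2.1 ht.1.1, hcov hs.1.1 ht.2.1, hcov hs.1.1 ht.1.1]
    ring
  -- With `α = H - γ/2` the pointwise order `2H - γ` is `2α` and the mean order `2 - γ` is `2α + δ`;
  -- `δ > 0` because `H < 1`.
  refine ae_memBesovOrlicz_of_covSecondDiff_le (δ := 2 - 2 * H) (K₀ := c * K₀) (K₁ := c * K₁)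
    (K₂ := c * K₂) (by linarith) (by linarith) hG (fun t ht => ht.1.le) hGmeas (by positivity)
    (by positivity) (fun t ht => ?_) (fun h hh s hs t ht => ?_) (fun h hh s hs => ?_)
  · rw [hcov ht.1 ht.1]
    exact mul_le_mul_of_nonneg_left
      ((le_abs_self _).trans (b₀ t t ht.1.le ht.2.le ht.1.le ht.2.le)) hc.le
  · rw [hsd hs ht, abs_mul, abs_of_pos hc, mul_assoc]
    have := b₁ h s t hh hs.1.1.le ht.1.1.le
    rw [show 2 * H - 2 + 2 - γ = 2 * (H - γ / 2) by ring] at this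
    exact mul_le_mul_of_nonneg_left this hc.le
  · calc _ = ∫⁻ t in shiftDomain h, ENNReal.ofReal c *
          ENNReal.ofReal |covSecondDiff (convCov γ (2 * H - 2)) h s t| := by
          refine setLIntegral_congr_fun (measurableSet_shiftDomain h) fun t ht => ?_
          rw [hsd hs ht, abs_mul, abs_of_pos hc, ENNReal.ofReal_mul hc.le]
      _ ≤ ENNReal.ofReal c * ENNReal.ofReal (K₂ * h ^ (2 - γ)) := by
          rw [lintegral_const_mul' _ _ ENNReal.ofReal_ne_top]
          refine mul_le_mul_right (le_trans ?_ (b₂ h s hh hs.1.1.le)) _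
          exact lintegral_mono_set fun t ht => ht.1
      _ = _ := by
          rw [← ENNReal.ofReal_mul hc.le, mul_assoc,
            show 2 * (H - γ / 2) + (2 - 2 * H) = 2 - γ by ring]
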